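/- **Definitions.** For 0–1 matrices $P\in\{0,1\}^{k\times l}$ and $A\in\{0,1\}^{n\times m}$, say that $A$ *contains* $P$ if there are row indices $r_1<\dots<r_k$ and column indices $c_1<\dots<c_l$ of $A$ with $A(r_i,c_j)=1$ whenever $P(i,j)=1$. Let $\operatorname{Ex}(P,n,m)$ be the maximum number of 1s in an $n\times m$ 0–1 matrix that does not contain $P$, and $\operatorname{Ex}(P,n)=\operatorname{Ex}(P,n,n)$. Let $$W=\begin{pmatrix}1&0&0&0&0\\0&0&0&0&1\\0&0&1&0&0\\0&1&0&1&0\end{pmatrix},\qquad \wedge=\begin{pmatrix}0&1&0\\1&0&1\end{pmatrix},$$ and let $W'$ be the mirror image of $W$ (columns in reverse order). Define $a_{1,j}=2^j$ for $j\ge1$, $a_{i,1}=2$ for $i\ge2$, and $a_{i,j}=w\cdot a_{i-1,w}$ with $w=a_{i,j-1}$ for $i,j\ge2$. For $n,m\ge1$ let $$\alpha(n,m)=\min\{i\ge1: a_{i,j}\ge m\},\quad j=\max\{3,\lceil n/m\rceil\},\qquad \alpha(n)=\alpha(n,n).$$ For a permutation $\pi$ of $\{1,\dots,k\}$ let $P_\pi$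 be the $k\times k$ permutation matrix whose 1 in column $i$ is in row $\pi(i)$, columns being numbered from left to right and rows from bottom to top, and let $P_\pi\otimes\wedge$ be the $2k\times3k$ Kronecker product (each 1 of $P_\pi$ is replaced by $\wedge$, each 0 by a $2\times 3$ block of 0s). $\pi$ contains a permutation $\sigma$ of $\{1,\dots,l\}$ if for some $i_1<\dots<i_l$ one has $\pi(i_p)<\pi(i_q)\Leftrightarrow\sigma(p)<\sigma(q)$ for all $p,q$. **Theorem.** 1. $\operatorname{Ex}(W,n,m)=\Theta\bigl(m+n\,2^{\alpha(n,m)}\bigr)$: there are absolute constants $c,C>0$ such that for all $n,m\ge1$ $$c\,\bigl(m+n2^{\alpha(n,m)}\bigr)\le\operatorname{Ex}(W,n,m)\le C\,\bigl(m+n2^{\alpha(n,m)}\bigr).$$ 2. In particular $\operatorname{Ex}(W,n)=\Theta\bigl(n\,2^{\alpha(n)}\bigr)$ as $n\to\infty$. 3. For every $k$ and every permutation $\pi$ of $\{1,\dots,k\}$: if $\pi$ contains $(3,1,2)$ then $P_\pi\otimes\wedge$ contains $W$, and if $\pi$ contains $(2,1,3)$ then $P_\pi\otimes\wedge$ contains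 $W'$. 4. Consequently $\operatorname{Ex}(P_\pi\otimes\wedge,n)=\Omega\bigl(n\,2^{\alpha(n)}\bigr)$ for every $\pi$ that contains $(3,1,2)$ or $(2,1,3)$: there is an absolute constant $c>0$ such that $\operatorname{Ex}(P_\pi\otimes\wedge,n)\ge c\,n\,2^{\alpha(n)}$ for all $k$, all such $\pi$ and all $n\ge1$. -/

import Mathlib

open Filter Asymptotics

namespace ZeroOneMatrix

/-- An `n × m` 0–1 matrix. As in a displayed matrix, row `0` is the top row and column `0`
is the leftmost column; `true` stands for the entry 1. -/
abbrev Mat (n m : ℕ) : Type := Matrix (Fin n) (Fin m) Bool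

/-- The number of 1s in a 0–1 matrix. -/
def weight {n m : ℕ} (A : Mat n m) : ℕ :=
  (Finset.univ.filter fun p : Fin n × Fin m => A p.1 p.2 = true).card

/-- `Contains P A`: there are rows `r₁ < ⋯ < r_k` and columns `c₁ < ⋯ < c_l` of `A` such that
`P i j = 1` implies `A (r i) (c j) = 1`. -/
def Contains {k l n m : ℕ} (P : Mat k l) (A : Mat n m) : Prop :=
  ∃ (r : Fin k → Fin n) (c : Fin l → Fin m), StrictMono r ∧ StrictMono c ∧
    ∀ i j, P i j = true → A (r i) (c j) = true

open Classical in
/-- The extremal function: the maximum number of 1s in an `n × m` 0–1 matrix that does not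
contain `P`. -/
noncomputable def Ex {k l : ℕ} (P : Mat k l) (n m : ℕ) : ℕ :=
  (Finset.univ.filter fun A : Mat n m => ¬ Contains P A).sup weight

/-- The light pattern `W`. -/
def W : Mat 4 5 := fun i j =>
  !![1, 0, 0, 0, 0;
     0, 0, 0, 0, 1;
     0, 0, 1, 0, 0;
     0, 1, 0, 1, 0] i j == 1

/-- The mirror image of `W` (the order of the columns is reversed). -/
def W' : Mat 4 5 := fun i j => W i j.rev

/-- The hat pattern. -/
def hat : Mat 2 3 := fun i j =>
  !![0, 1, 0;
     1, 0, 1] i j == 1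

/-- The permutation matrix of `π`: in column `j` the 1 is in the row whose number,
counted from the bottom, is `π j`. -/
def permMatrix {k : ℕ} (π : Equiv.Perm (Fin k)) : Mat k k := fun i j => i.rev == π j

/-- The Kronecker product of two 0–1 matrices: each 1 of `P` is replaced by a copy of `R`,
each 0 by a block of 0s. -/
def kron {k l p q : ℕ} (P : Mat k l) (R : Mat p q) : Mat (k * p) (l * q) :=
  Matrix.reindex finProdFinEquiv finProdFinEquiv (Matrix.kroneckerMap and P R)

/-- `π` contains the permutation whose one-line notation is `σ`. -/
def PermContains {k l : ℕ} (π : Equiv.Perm (Fin k)) (σ : Fin l → ℕ) : Prop :=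
  ∃ f : Fin l → Fin k, StrictMono f ∧ ∀ p q, π (f p) < π (f q) ↔ σ p < σ q

/-- The Ackermann function `a i j` for `i, j ≥ 1`: `a 1 j = 2 ^ j`, `a i 1 = 2` for `i ≥ 2`, and
`a i j = w * a (i - 1) w` with `w = a i (j - 1)` for `i, j ≥ 2`. (The values at `i = 0` and
at `j = 0` are never used.) -/
def a : ℕ → ℕ → ℕ
  | 0, _ => 0
  | 1, j => 2 ^ j
  | _ + 2, 0 => 0
  | _ + 2, 1 => 2
  | i + 2, j + 2 => a (i + 2) (j + 1) * a (i + 1) (a (i + 2) (j + 1))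
termination_by i j => (i, j)

/-- The two-parameter inverse: `α(n, m) = min {i ≥ 1 : a_{i,j} ≥ m}`, `j = max {3, ⌈n / m⌉}`. -/
noncomputable def alpha (n m : ℕ) : ℕ :=
  sInf {i : ℕ | 1 ≤ i ∧ m ≤ a i (max 3 ⌈(n : ℚ) / (m : ℚ)⌉₊)}

end ZeroOneMatrix

namespace ZeroOneMatrix

/-! ### Point sets -/

/-! Upper bound. Cut the columns of a `W`-free set into blocks of `w ^ 2` columns, `w = ack (i + 1)
j`. Rows meeting one block are handled by induction on `j`. The points of any other row lie in its
first block, its last block or a middle one. A row of a first part continues to the right of the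
block, which supplies the rightmost 1 of `W`; a row of a last part has a point to the left, which
supplies the leftmost 1. Hence first and last parts avoid, up to small corrections, the pattern with
columns `a d c d` or the mirror of such a pattern, and middle parts avoid the hat. The same block
scheme bounds `a d c d` with a row coefficient linear in `i` (`VFree.card_le`), because its middle
parts avoid a pattern that costs only 1 per row. The hat costs 2 per row of each middle block, and
contracting every block to one column leaves a `W`-free set at level `i`. So the row coefficient of
`W` doubles at each level, up to a term linear in `i`, and is `O(2 ^ i)` (`WFree.card_le`). A
suitable level and index then give the bound in terms of `alpha` (`WFree.card_le_alpha`).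

Lower bound. An outer matrix whose columns each carry `w` 1s is composed with copies of an inner
matrix having `w` columns. Every outer column becomes two half blocks of `w` columns, and its 1s are
spread over the left half in one order and over the right half in the opposite order. A copy of the
inner matrix is put into each half block, on new rows above all outer 1s met so far. This creates no
`W` (`sparse_compose`). Using each outer 1 twice doubles the ratio of weight to rows, which is
exactly `2 ^ i` at level `i` (`exists_config`), while the number of columns grows like the Ackermann
function (`numCols_le_ack`). Diagonal copies adapt the construction to arbitrary `n`, `m`
(`le_Ex_W`).

Kronecker products. In `312` or `213` the hat of the smallest entry supplies the two lower rows of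
`W` or `W'`, and one 1 from each of the other two hats supplies the rest. -/

/-- The nonempty rows of a finite point set. -/
def rows (S : Finset (ℕ × ℕ)) : Finset ℕ := S.image Prod.fst

/-- The nonempty columns of a finite point set. -/
def cols (S : Finset (ℕ × ℕ)) : Finset ℕ := S.image Prod.snd

lemma mem_rows {S : Finset (ℕ × ℕ)} {r : ℕ} : r ∈ rows S ↔ ∃ x, (r, x) ∈ S := by
  simp [rows]

lemma mem_cols {S : Finset (ℕ × ℕ)} {x : ℕ} : x ∈ cols S ↔ ∃ r, (r, x) ∈ S := by
  simp [cols]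

lemma rows_mono {S T : Finset (ℕ × ℕ)} (h : S ⊆ T) : (rows S).card ≤ (rows T).card :=
  Finset.card_le_card (Finset.image_subset_image h)

lemma cols_mono {S T : Finset (ℕ × ℕ)} (h : S ⊆ T) : (cols S).card ≤ (cols T).card :=
  Finset.card_le_card (Finset.image_subset_image h)

lemma card_le_rows_of_unique {S T : Finset (ℕ × ℕ)} (hST : S ⊆ T)
    (h : ∀ r x y, (r, x) ∈ S → (r, y) ∈ S → ¬ x < y) : S.card ≤ (rows T).card := by
  refine Finset.card_le_card_of_injOn Prod.fst
    (fun p hp => Finset.mem_coe.2 (Finset.mem_image_of_mem _ (hST hp))) ?_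
  rintro ⟨r, x⟩ hp ⟨r', y⟩ hq (rfl : r = r')
  have h1 := h r x y hp hq
  have h2 := h r y x hq hp
  rw [show x = y by omega]

lemma card_le_cols_of_unique {S T : Finset (ℕ × ℕ)} (hST : S ⊆ T)
    (h : ∀ r s x, (r, x) ∈ S → (s, x) ∈ S → ¬ r < s) : S.card ≤ (cols T).card := by
  refine Finset.card_le_card_of_injOn Prod.snd
    (fun p hp => Finset.mem_coe.2 (Finset.mem_image_of_mem _ (hST hp))) ?_
  rintro ⟨r, x⟩ hp ⟨s, x'⟩ hq (rfl : x = x')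
  have h1 := h r s x hp hq
  have h2 := h s r x hq hp
  rw [show r = s by omega]

lemma card_le_mul (S : Finset (ℕ × ℕ)) : S.card ≤ (cols S).card * (rows S).card := by
  rw [mul_comm, ← Finset.card_product]
  refine Finset.card_le_card fun p hp => Finset.mem_product.2 ⟨?_, ?_⟩
  · exact Finset.mem_image_of_mem _ hp
  · exact Finset.mem_image_of_mem _ hp

lemma one_le_cols {S : Finset (ℕ × ℕ)} (h : S.Nonempty) : 1 ≤ (cols S).card :=
  Finset.card_pos.2 (h.image _)

/-- The point `p` has another point of `S` to its left in its row. -/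
def HasLeft (S : Finset (ℕ × ℕ)) (p : ℕ × ℕ) : Prop := ∃ x, (p.1, x) ∈ S ∧ x < p.2

/-- The point `p` has another point of `S` to its right in its row. -/
def HasRight (S : Finset (ℕ × ℕ)) (p : ℕ × ℕ) : Prop := ∃ x, (p.1, x) ∈ S ∧ p.2 < x

open Classical in
lemma card_le_left (S : Finset (ℕ × ℕ)) :
    S.card ≤ (rows S).card + (S.filter (HasLeft S)).card := by
  have h : (S.filter fun p => ¬ HasLeft S p).card ≤ (rows S).card := by
    refine card_le_rows_of_unique (Finset.filter_subset _ _) fun r x y hx hy hxy => ?_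
    rw [Finset.mem_filter] at hx hy
    exact hy.2 ⟨x, hx.1, hxy⟩
  have := Finset.card_filter_add_card_filter_not (s := S) (HasLeft S)
  omega

open Classical in
lemma card_le_left_right (S : Finset (ℕ × ℕ)) :
    S.card ≤ 2 * (rows S).card + (S.filter fun p => HasLeft S p ∧ HasRight S p).card := by
  have h1 := card_le_left S
  have h : ((S.filter (HasLeft S)).filter fun p => ¬ HasRight S p).card ≤ (rows S).card := by
    refine card_le_rows_of_unique
      ((Finset.filter_subset _ _).trans (Finset.filter_subset _ _)) fun r x y hx hy hxy => ?_
    rw [Finset.mem_filter, Finset.mem_filter] at hx hy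
    exact hx.2 ⟨y, hy.1.1, hxy⟩
  have := Finset.card_filter_add_card_filter_not (s := S.filter (HasLeft S)) (HasRight S)
  rw [Finset.filter_filter] at this
  omega

/-! ### Forbidden patterns with linear extremal function -/

/-- `S` avoids the hat pattern. -/
def HatFree (S : Finset (ℕ × ℕ)) : Prop := ∀ c d x y z, c < d → x < y → y < z →
  (d, x) ∈ S → (c, y) ∈ S → (d, z) ∉ S

/-- `S` avoids the pattern with columns `d c`, where `c` is above `d`. -/
def AscentFree (S : Finset (ℕ × ℕ)) : Prop := ∀ c d x y, c < d → x < y →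
  (d, x) ∈ S → (c, y) ∉ S

/-- `S` avoids the permutation pattern with columns `a d c`, the rows being `a`, `c`, `d`. -/
def PermFree (S : Finset (ℕ × ℕ)) : Prop := ∀ a c d x y z, a < c → c < d → x < y → y < z →
  (a, x) ∈ S → (d, y) ∈ S → (c, z) ∉ S

/-- Delete the first and last point of every row. If two points remained in one column, the lower
would have row neighbours on both sides, with the upper as the tip of a hat. -/
lemma HatFree.card_le {S : Finset (ℕ × ℕ)} (h : HatFree S) :
    S.card ≤ 2 * (rows S).card + (cols S).card := by
  classical
  refine (card_le_left_right S).trans (Nat.add_le_add_left ?_ _)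
  refine card_le_cols_of_unique (Finset.filter_subset _ _) fun r s x hr hs hrs => ?_
  rw [Finset.mem_filter] at hr hs
  obtain ⟨-, ⟨y, hy, hyx⟩, ⟨z, hz, hxz⟩⟩ := hs
  exact h r s y x z hrs hyx hxz hy hr.1 hz

lemma AscentFree.card_le {S : Finset (ℕ × ℕ)} (h : AscentFree S) :
    S.card ≤ (rows S).card + (cols S).card := by
  classical
  refine (card_le_left S).trans (Nat.add_le_add_left ?_ _)
  refine card_le_cols_of_unique (Finset.filter_subset _ _) fun r s x hr hs hrs => ?_
  rw [Finset.mem_filter] at hr hs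
  obtain ⟨-, y, hy, hyx⟩ := hs
  exact h r s y x hrs hyx hy hr.1

/-- After deleting the ends of every row, a column keeps at most two points. Of three, the top one
has a point to its left, the middle one a point to its right, and these form the pattern with the
bottom one. -/
lemma PermFree.card_le {S : Finset (ℕ × ℕ)} (h : PermFree S) :
    S.card ≤ 2 * (rows S).card + 2 * (cols S).card := by
  classical
  refine (card_le_left_right S).trans (Nat.add_le_add_left ?_ _)
  refine Finset.card_le_mul_card_image_of_maps_to (f := Prod.snd) (n := 2) ?_ ?_ |>.trans_eq rfl
  · intro p hp
    exact Finset.mem_image_of_mem _ (Finset.mem_filter.1 hp).1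
  · intro x _
    by_contra! hcon
    set U := (S.filter fun p => HasLeft S p ∧ HasRight S p).filter fun p => p.2 = x with hU
    have hcard : U.card = (U.image Prod.fst).card := by
      refine (Finset.card_image_of_injOn ?_).symm
      rintro ⟨r, y⟩ hp ⟨s, z⟩ hq (rfl : r = s)
      have h1 := (Finset.mem_filter.1 hp).2
      have h2 := (Finset.mem_filter.1 hq).2
      simp only at h1 h2
      rw [h1, h2]
    rw [hcard] at hcon
    have hmem : ∀ r ∈ U.image Prod.fst, (r, x) ∈ S ∧ HasLeft S (r, x) ∧ HasRight S (r, x) := by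
      intro r hr
      obtain ⟨⟨r', y⟩, hp, rfl⟩ := Finset.mem_image.1 hr
      simp only [hU, Finset.mem_filter] at hp
      obtain ⟨hp, rfl⟩ := hp
      exact hp
    let e := (U.image Prod.fst).orderEmbOfFin rfl
    have he : ∀ i, e i ∈ U.image Prod.fst := fun i => Finset.orderEmbOfFin_mem _ rfl i
    have h01 : e ⟨0, by omega⟩ < e ⟨1, by omega⟩ := e.strictMono (by simp [Fin.lt_def])
    have h12 : e ⟨1, by omega⟩ < e ⟨2, by omega⟩ := e.strictMono (by simp [Fin.lt_def])
    obtain ⟨-, ⟨y, hy, hyx⟩, -⟩ := hmem _ (he ⟨0, by omega⟩)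
    obtain ⟨-, -, ⟨z, hz, hxz⟩⟩ := hmem _ (he ⟨1, by omega⟩)
    exact h _ _ _ y x z h01 h12 hyx hxz hy (hmem _ (he ⟨2, by omega⟩)).1 hz

/-! ### Removing the top row -/

/-- The points of `S` that are not in its top row. -/
def dropTop (S : Finset (ℕ × ℕ)) : Finset (ℕ × ℕ) := S.filter fun p => ∃ r ∈ rows S, r < p.1

lemma dropTop_subset (S : Finset (ℕ × ℕ)) : dropTop S ⊆ S := Finset.filter_subset _ _

lemma exists_above {S : Finset (ℕ × ℕ)} {r x : ℕ} (h : (r, x) ∈ dropTop S) :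
    ∃ a y, a < r ∧ (a, y) ∈ S := by
  obtain ⟨-, a, ha, har⟩ := Finset.mem_filter.1 h
  obtain ⟨y, hy⟩ := mem_rows.1 ha
  exact ⟨a, y, har, hy⟩

lemma card_le_dropTop (S : Finset (ℕ × ℕ)) : S.card ≤ (cols S).card + (dropTop S).card := by
  have h : (S.filter fun p => ¬ ∃ r ∈ rows S, r < p.1).card ≤ (cols S).card := by
    refine card_le_cols_of_unique (Finset.filter_subset _ _) fun r s x hr hs hrs => ?_
    rw [Finset.mem_filter] at hr hs
    exact hs.2 ⟨r, mem_rows.2 ⟨x, hr.1⟩, hrs⟩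
  have := Finset.card_filter_add_card_filter_not (s := S) (fun p => ∃ r ∈ rows S, r < p.1)
  unfold dropTop
  omega

/-! ### Blocks of columns -/

/-- Contraction of the blocks (fibres of `β`) of columns. -/
def contract (β : ℕ → ℕ) (S : Finset (ℕ × ℕ)) : Finset (ℕ × ℕ) := S.image fun p => (p.1, β p.2)

/-- The part of `S` in the block `B`. -/
def block (β : ℕ → ℕ) (S : Finset (ℕ × ℕ)) (B : ℕ) : Finset (ℕ × ℕ) := S.filter fun p => β p.2 = B

lemma mem_contract {β : ℕ → ℕ} {S : Finset (ℕ × ℕ)} {r B : ℕ} :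
    (r, B) ∈ contract β S ↔ ∃ x, (r, x) ∈ S ∧ β x = B := by
  simp [contract]

lemma mem_block {β : ℕ → ℕ} {S : Finset (ℕ × ℕ)} {B : ℕ} {p : ℕ × ℕ} :
    p ∈ block β S B ↔ p ∈ S ∧ β p.2 = B := by
  simp [block]

lemma block_subset (β : ℕ → ℕ) (S : Finset (ℕ × ℕ)) (B : ℕ) : block β S B ⊆ S :=
  Finset.filter_subset _ _

lemma rows_contract (β : ℕ → ℕ) (S : Finset (ℕ × ℕ)) : rows (contract β S) = rows S := by
  ext r
  simp [mem_rows, mem_contract]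

lemma cols_contract (β : ℕ → ℕ) (S : Finset (ℕ × ℕ)) :
    cols (contract β S) = (cols S).image β := by
  ext r
  simp only [mem_cols, mem_contract, Finset.mem_image]
  grind

/-- Summation over blocks: a row of a block is a point of the contraction, so row terms add up to
`(contract β S).card`. The subtracted 1 survives since a nonempty `S` has a nonempty block; it is
needed because `q` blocks of `w ^ 2` columns only guarantee `w ^ 2 * (q - 1) ≤ C - 1`. -/
lemma card_le_of_blocks {β : ℕ → ℕ} {S : Finset (ℕ × ℕ)} {p c e : ℕ}
    (h : ∀ B, (block β S B).card ≤ p * (rows (block β S B)).card + c * (cols (block β S B)).card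
      + e * ((cols (block β S B)).card - 1)) :
    S.card ≤ p * (contract β S).card + c * (cols S).card + e * ((cols S).card - 1) := by
  set I := (cols S).image β with hI
  have hS : S.card = ∑ B ∈ I, (block β S B).card :=
    Finset.card_eq_sum_card_fiberwise (f := fun p : ℕ × ℕ => β p.2) fun q hq => by
      exact Finset.mem_coe.2 (Finset.mem_image_of_mem _ (Finset.mem_image_of_mem _ hq))
  have hC : (cols S).card = ∑ B ∈ I, (cols (block β S B)).card := by
    rw [Finset.card_eq_sum_card_fiberwise (f := β) (t := I) fun q hq => by
      exact Finset.mem_coe.2 (Finset.mem_image_of_mem _ hq)]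
    refine Finset.sum_congr rfl fun B _ => ?_
    congr 1
    ext x
    simp only [Finset.mem_filter, mem_cols, mem_block]
    grind
  have hR : (contract β S).card = ∑ B ∈ I, (rows (block β S B)).card := by
    rw [Finset.card_eq_sum_card_fiberwise (f := Prod.snd) (t := I) fun q hq => by
      rw [hI, ← cols_contract]
      exact Finset.mem_coe.2 (Finset.mem_image_of_mem _ hq)]
    refine Finset.sum_congr rfl fun B _ => ?_
    rw [← Finset.card_image_of_injOn (s := (contract β S).filter fun q => q.2 = B) (f := Prod.fst)]
    · congr 1
      ext r
      simp only [Finset.mem_image, Finset.mem_filter, Prod.exists, exists_and_right,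
        exists_eq_right, mem_rows, mem_block]
      constructor
      · exact fun h1 => mem_contract.1 h1
      · exact fun h1 => mem_contract.2 h1
    · rintro ⟨r, y⟩ hp ⟨s, z⟩ hq (rfl : r = s)
      have h1 := (Finset.mem_filter.1 hp).2
      have h2 := (Finset.mem_filter.1 hq).2
      simp only at h1 h2
      rw [h1, h2]
  have hC1 : ∑ B ∈ I, ((cols (block β S B)).card - 1) ≤ (cols S).card - 1 := by
    rcases I.eq_empty_or_nonempty with h0 | h0
    · simp [h0]
    · have hpos : ∀ B ∈ I, 1 ≤ (cols (block β S B)).card := by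
        intro B hB
        obtain ⟨x, hx, rfl⟩ := Finset.mem_image.1 hB
        obtain ⟨r, hr⟩ := mem_cols.1 hx
        exact one_le_cols ⟨_, mem_block.2 ⟨hr, rfl⟩⟩
      have h2 : ∑ B ∈ I, ((cols (block β S B)).card - 1) + I.card = (cols S).card := by
        rw [hC, Finset.card_eq_sum_ones, ← Finset.sum_add_distrib]
        exact Finset.sum_congr rfl fun B hB => Nat.sub_add_cancel (hpos B hB)
      have := h0.card_pos
      omega
  calc S.card ≤ ∑ B ∈ I, (p * (rows (block β S B)).card + c * (cols (block β S B)).card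
      + e * ((cols (block β S B)).card - 1)) := by
        rw [hS]
        exact Finset.sum_le_sum fun B _ => h B
    _ = p * (contract β S).card + c * (cols S).card
        + e * ∑ B ∈ I, ((cols (block β S B)).card - 1) := by
        rw [hR, hC, Finset.sum_add_distrib, Finset.sum_add_distrib, Finset.mul_sum, Finset.mul_sum,
          Finset.mul_sum]
    _ ≤ _ := by gcongr

/-- The row of `p` has a point in an earlier block. -/
def BlockLeft (β : ℕ → ℕ) (S : Finset (ℕ × ℕ)) (p : ℕ × ℕ) : Prop :=
  ∃ x, (p.1, x) ∈ S ∧ β x < β p.2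

/-- The row of `p` has a point in a later block. -/
def BlockRight (β : ℕ → ℕ) (S : Finset (ℕ × ℕ)) (p : ℕ × ℕ) : Prop :=
  ∃ x, (p.1, x) ∈ S ∧ β p.2 < β x

open Classical in
/-- The points in rows that meet only one block. -/
noncomputable def localPart (β : ℕ → ℕ) (S : Finset (ℕ × ℕ)) : Finset (ℕ × ℕ) :=
  S.filter fun p => ¬ BlockLeft β S p ∧ ¬ BlockRight β S p

open Classical in
/-- The points in rows that meet at least two blocks. -/
noncomputable def globalPart (β : ℕ → ℕ) (S : Finset (ℕ × ℕ)) : Finset (ℕ × ℕ) :=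
  S.filter fun p => BlockLeft β S p ∨ BlockRight β S p

open Classical in
/-- The points in the first block of a row that meets at least two blocks. -/
noncomputable def firstPart (β : ℕ → ℕ) (S : Finset (ℕ × ℕ)) : Finset (ℕ × ℕ) :=
  S.filter fun p => ¬ BlockLeft β S p ∧ BlockRight β S p

open Classical in
/-- The points in the last block of a row that meets at least two blocks. -/
noncomputable def lastPart (β : ℕ → ℕ) (S : Finset (ℕ × ℕ)) : Finset (ℕ × ℕ) :=
  S.filter fun p => BlockLeft β S p ∧ ¬ BlockRight β S p

open Classical in
/-- The points in neither the first nor the last block of their row. -/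
noncomputable def midPart (β : ℕ → ℕ) (S : Finset (ℕ × ℕ)) : Finset (ℕ × ℕ) :=
  S.filter fun p => BlockLeft β S p ∧ BlockRight β S p

section parts

open Classical

variable (β : ℕ → ℕ) (S : Finset (ℕ × ℕ))

lemma localPart_subset : localPart β S ⊆ S := Finset.filter_subset _ _
lemma globalPart_subset : globalPart β S ⊆ S := Finset.filter_subset _ _
lemma firstPart_subset : firstPart β S ⊆ S := Finset.filter_subset _ _
lemma lastPart_subset : lastPart β S ⊆ S := Finset.filter_subset _ _
lemma midPart_subset : midPart β S ⊆ S := Finset.filter_subset _ _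

lemma card_parts : S.card = (localPart β S).card + (firstPart β S).card + (lastPart β S).card
    + (midPart β S).card := by
  have h1 := Finset.card_filter_add_card_filter_not (s := S) (BlockLeft β S)
  have h2 := Finset.card_filter_add_card_filter_not (s := S.filter (BlockLeft β S))
    (BlockRight β S)
  have h3 := Finset.card_filter_add_card_filter_not (s := S.filter fun p => ¬ BlockLeft β S p)
    (BlockRight β S)
  rw [Finset.filter_filter, Finset.filter_filter] at h2 h3
  unfold localPart firstPart lastPart midPart
  omega

lemma rows_local_add_global :
    (rows (localPart β S)).card + (rows (globalPart β S)).card ≤ (rows S).card := by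
  rw [← Finset.card_union_of_disjoint]
  · refine Finset.card_le_card (Finset.union_subset ?_ ?_)
    · exact Finset.image_subset_image (localPart_subset β S)
    · exact Finset.image_subset_image (globalPart_subset β S)
  · rw [Finset.disjoint_left]
    intro r h1 h2
    obtain ⟨x, hx⟩ := mem_rows.1 h1
    obtain ⟨y, hy⟩ := mem_rows.1 h2
    simp only [localPart, globalPart, BlockLeft, BlockRight] at hx hy
    grind

lemma card_contract_local : (contract β (localPart β S)).card ≤ (rows (localPart β S)).card := by
  rw [← rows_contract β]
  refine card_le_rows_of_unique subset_rfl fun r x y hx hy hxy => ?_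
  simp only [mem_contract, localPart, BlockLeft, BlockRight] at hx hy
  grind

lemma card_contract_first : (contract β (firstPart β S)).card ≤ (rows (globalPart β S)).card := by
  rw [← rows_contract β (globalPart β S)]
  refine card_le_rows_of_unique (Finset.image_subset_image ?_) fun r x y hx hy hxy => ?_
  · intro p
    simp only [firstPart, globalPart, Finset.mem_filter]
    tauto
  · simp only [mem_contract, firstPart, BlockLeft, BlockRight] at hx hy
    grind

lemma card_contract_last : (contract β (lastPart β S)).card ≤ (rows (globalPart β S)).card := by
  rw [← rows_contract β (globalPart β S)]
  refine card_le_rows_of_unique (Finset.image_subset_image ?_) fun r x y hx hy hxy => ?_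
  · intro p
    simp only [lastPart, globalPart, Finset.mem_filter]
    tauto
  · simp only [mem_contract, lastPart, BlockLeft, BlockRight] at hx hy
    grind

lemma card_contract_mid :
    (contract β (midPart β S)).card ≤ (contract β (globalPart β S)).card := by
  refine Finset.card_le_card (Finset.image_subset_image fun p => ?_)
  simp only [midPart, globalPart, Finset.mem_filter]
  tauto

end parts

/-- Division of the columns into blocks of `k` consecutive nonempty columns. -/
lemma exists_blocks (S : Finset (ℕ × ℕ)) {k : ℕ} (hk : 0 < k) :
    ∃ β : ℕ → ℕ, Monotone β ∧ (∀ T ⊆ S, ∀ B, (cols (block β T B)).card ≤ k) ∧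
      ∀ T ⊆ S, (cols (contract β T)).card ≤ ((cols S).card - 1) / k + 1 := by
  let ρ : ℕ → ℕ := fun x => ((cols S).filter (· < x)).card
  have hmono : Monotone ρ := fun x y hxy => Finset.card_le_card fun z hz => by
    simp only [Finset.mem_filter] at hz ⊢
    exact ⟨hz.1, hz.2.trans_le hxy⟩
  have hstrict : ∀ x ∈ cols S, ∀ y, x < y → ρ x < ρ y := by
    intro x hx y hxy
    refine Finset.card_lt_card ⟨fun z hz => ?_, fun h => ?_⟩
    · simp only [Finset.mem_filter] at hz ⊢
      exact ⟨hz.1, hz.2.trans hxy⟩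
    · have := h (Finset.mem_filter.2 ⟨hx, hxy⟩)
      simp at this
  -- `ρ` ranks a column among the nonempty ones, so empty columns do not use up room in a block.
  refine ⟨fun x => ρ x / k, fun x y hxy => Nat.div_le_div_right (hmono hxy), ?_, ?_⟩
  · intro T hT B
    have hsub : cols T ⊆ cols S := Finset.image_subset_image hT
    calc (cols (block (fun x => ρ x / k) T B)).card
        ≤ (Finset.Ico (B * k) (B * k + k)).card := by
          refine Finset.card_le_card_of_injOn ρ ?_ ?_
          · intro x hx
            obtain ⟨r, hr⟩ := mem_cols.1 (Finset.mem_coe.1 hx)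
            obtain ⟨-, hB⟩ := mem_block.1 hr
            simp only at hB
            rw [Finset.coe_Ico, Set.mem_Ico, ← hB]
            exact ⟨Nat.div_mul_le_self _ _, Nat.lt_div_mul_add hk⟩
          · intro x hx y hy hxy
            have hx' := hsub (Finset.image_subset_image (block_subset _ _ _) (Finset.mem_coe.1 hx))
            have hy' := hsub (Finset.image_subset_image (block_subset _ _ _) (Finset.mem_coe.1 hy))
            rcases lt_trichotomy x y with h | h | h
            · exact absurd hxy (hstrict x hx' y h).ne
            · exact h
            · exact absurd hxy (hstrict y hy' x h).ne'
      _ = k := by simp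
  · intro T hT
    rw [cols_contract]
    calc _ ≤ (Finset.range (((cols S).card - 1) / k + 1)).card := by
          refine Finset.card_le_card fun B hB => ?_
          obtain ⟨x, hx, rfl⟩ := Finset.mem_image.1 hB
          have hx' : x ∈ cols S := Finset.image_subset_image hT hx
          rw [Finset.mem_range, Nat.lt_succ_iff]
          refine Nat.div_le_div_right (Nat.le_sub_one_of_lt (Finset.card_lt_card ?_))
          refine ⟨Finset.filter_subset _ _, fun h => ?_⟩
          have := h hx'
          simp at this
      _ = _ := by simp

/-! ### The Ackermann function indexed from zero -/

/-- The function `a`, extended to all indices. -/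
def ack : ℕ → ℕ → ℕ
  | 0, _ => 2
  | _ + 1, 0 => 1
  | i + 1, j + 1 => ack (i + 1) j * ack i (ack (i + 1) j)
termination_by i j => (i, j)

lemma ack_zero (j : ℕ) : ack 0 j = 2 := by rw [ack]
lemma ack_succ_zero (i : ℕ) : ack (i + 1) 0 = 1 := by rw [ack]
lemma ack_succ_succ (i j : ℕ) :
    ack (i + 1) (j + 1) = ack (i + 1) j * ack i (ack (i + 1) j) := by rw [ack]

lemma ack_one_right (i : ℕ) : ack i 1 = 2 := by
  induction i with
  | zero => exact ack_zero 1
  | succ i ih => rw [ack_succ_succ, ack_succ_zero, ih]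

/-- With the constant 2 as level 0, the powers of 2 also come from the recursion, so the inductions
can start at level 0, where the bounds are trivial. -/
lemma ack_one (j : ℕ) : ack 1 j = 2 ^ j := by
  induction j with
  | zero => exact ack_succ_zero 0
  | succ j ih => rw [ack_succ_succ, ih, ack_zero, pow_succ]

lemma ack_pos (i j : ℕ) : 0 < ack i j := by
  induction i generalizing j with
  | zero => simp [ack_zero]
  | succ i ih =>
    induction j with
    | zero => simp [ack_succ_zero]
    | succ j ihj => rw [ack_succ_succ]; exact Nat.mul_pos ihj (ih _)

lemma a_eq_ack (i j : ℕ) : a (i + 1) (j + 1) = ack (i + 1) (j + 1) := by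
  induction i generalizing j with
  | zero => rw [ack_one, a]
  | succ i ih =>
    induction j with
    | zero => rw [ack_one_right, zero_add, a]
    | succ j ihj =>
      rw [ack_succ_succ, a, ihj]
      obtain ⟨w, hw⟩ := Nat.exists_eq_succ_of_ne_zero (ack_pos (i + 1 + 1) (j + 1)).ne'
      rw [hw, Nat.succ_eq_add_one, ih]

/-! ### The pattern with columns `a d c d` -/

/-- `S` avoids the pattern with columns `a d c d` and rows `a < c < d`. -/
def VFree (S : Finset (ℕ × ℕ)) : Prop := ∀ a c d x y z t, a < c → c < d → x < y → y < z → z < t →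
  (a, x) ∈ S → (d, y) ∈ S → (c, z) ∈ S → (d, t) ∉ S

lemma VFree.mono {S T : Finset (ℕ × ℕ)} (h : VFree S) (hT : T ⊆ S) : VFree T :=
  fun a c d x y z t h1 h2 h3 h4 h5 p1 p2 p3 p4 =>
    h a c d x y z t h1 h2 h3 h4 h5 (hT p1) (hT p2) (hT p3) (hT p4)

/-- An occurrence in the contraction lifts, since points in strictly increasing blocks lie in
strictly increasing columns. -/
lemma VFree.contraction {S : Finset (ℕ × ℕ)} (h : VFree S) {β : ℕ → ℕ} (hβ : Monotone β) :
    VFree (contract β S) := by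
  intro a c d x y z t h1 h2 h3 h4 h5 p1 p2 p3 p4
  obtain ⟨x, q1, rfl⟩ := mem_contract.1 p1
  obtain ⟨y, q2, rfl⟩ := mem_contract.1 p2
  obtain ⟨z, q3, rfl⟩ := mem_contract.1 p3
  obtain ⟨t, q4, rfl⟩ := mem_contract.1 p4
  exact h a c d x y z t h1 h2 (hβ.reflect_lt h3) (hβ.reflect_lt h4) (hβ.reflect_lt h5) q1 q2 q3 q4

lemma mem_firstPart {β : ℕ → ℕ} {S : Finset (ℕ × ℕ)} {p : ℕ × ℕ} :
    p ∈ firstPart β S ↔ p ∈ S ∧ ¬ BlockLeft β S p ∧ BlockRight β S p := by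
  classical
  exact Finset.mem_filter

lemma mem_lastPart {β : ℕ → ℕ} {S : Finset (ℕ × ℕ)} {p : ℕ × ℕ} :
    p ∈ lastPart β S ↔ p ∈ S ∧ BlockLeft β S p ∧ ¬ BlockRight β S p := by
  classical
  exact Finset.mem_filter

lemma mem_midPart {β : ℕ → ℕ} {S : Finset (ℕ × ℕ)} {p : ℕ × ℕ} :
    p ∈ midPart β S ↔ p ∈ S ∧ BlockLeft β S p ∧ BlockRight β S p := by
  classical
  exact Finset.mem_filter

/-- A point of a block that lies in the middle or last part of its row has a point of its row
before each point of the block. -/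
lemma exists_before {β : ℕ → ℕ} (hβ : Monotone β) {S : Finset (ℕ × ℕ)} {r x B : ℕ}
    (h : BlockLeft β S (r, x)) (hB : β x = B) : ∃ y, (r, y) ∈ S ∧ ∀ z, β z = B → y < z := by
  obtain ⟨y, hy, hlt⟩ := h
  exact ⟨y, hy, fun z hz => hβ.reflect_lt (by rw [hz, ← hB]; exact hlt)⟩

lemma exists_after {β : ℕ → ℕ} (hβ : Monotone β) {S : Finset (ℕ × ℕ)} {r x B : ℕ}
    (h : BlockRight β S (r, x)) (hB : β x = B) : ∃ y, (r, y) ∈ S ∧ ∀ z, β z = B → z < y := by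
  obtain ⟨y, hy, hlt⟩ := h
  exact ⟨y, hy, fun z hz => hβ.reflect_lt (by rw [hz, ← hB]; exact hlt)⟩

lemma VFree.permFree_first {S : Finset (ℕ × ℕ)} (h : VFree S) {β : ℕ → ℕ} (hβ : Monotone β)
    (B : ℕ) : PermFree (block β (firstPart β S) B) := by
  intro a c d x y z h1 h2 h3 h4 p1 p2 p3
  obtain ⟨p1, -⟩ := mem_block.1 p1
  obtain ⟨p2, e2⟩ := mem_block.1 p2
  obtain ⟨p3, e3⟩ := mem_block.1 p3
  obtain ⟨p2, -, q2⟩ := mem_firstPart.1 p2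
  obtain ⟨t, ht, hlt⟩ := exists_after hβ q2 e2
  exact h a c d x y z t h1 h2 h3 h4 (hlt z e3) (firstPart_subset _ _ p1) p2
    (firstPart_subset _ _ p3) ht

lemma VFree.hatFree_last {S : Finset (ℕ × ℕ)} (h : VFree S) {β : ℕ → ℕ} (hβ : Monotone β)
    (B : ℕ) : HatFree (dropTop (block β (lastPart β S) B)) := by
  intro c d y z t h2 h4 h5 p2 p3 p4
  obtain ⟨a, x, h1, p1⟩ := exists_above p3
  obtain ⟨p1, e1⟩ := mem_block.1 p1
  obtain ⟨p2, e2⟩ := mem_block.1 (dropTop_subset _ p2)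
  obtain ⟨p3, -⟩ := mem_block.1 (dropTop_subset _ p3)
  obtain ⟨p4, -⟩ := mem_block.1 (dropTop_subset _ p4)
  obtain ⟨p1, q1, -⟩ := mem_lastPart.1 p1
  obtain ⟨x', hx, hlt⟩ := exists_before hβ q1 e1
  exact h a c d x' y z t h1 h2 (hlt y e2) h4 h5 hx (lastPart_subset _ _ p2)
    (lastPart_subset _ _ p3) (lastPart_subset _ _ p4)

lemma VFree.ascentFree_mid {S : Finset (ℕ × ℕ)} (h : VFree S) {β : ℕ → ℕ} (hβ : Monotone β)
    (B : ℕ) : AscentFree (dropTop (block β (midPart β S) B)) := by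
  intro c d y z h2 h4 p2 p3
  obtain ⟨a, x, h1, p1⟩ := exists_above p3
  obtain ⟨p1, e1⟩ := mem_block.1 p1
  obtain ⟨p2, e2⟩ := mem_block.1 (dropTop_subset _ p2)
  obtain ⟨p3, e3⟩ := mem_block.1 (dropTop_subset _ p3)
  obtain ⟨p1, q1, -⟩ := mem_midPart.1 p1
  obtain ⟨p2, -, q2⟩ := mem_midPart.1 p2
  obtain ⟨x', hx, hlt⟩ := exists_before hβ q1 e1
  obtain ⟨t, ht, hgt⟩ := exists_after hβ q2 e2
  exact h a c d x' y z t h1 h2 (hlt y e2) h4 (hgt z e3) hx p2 (midPart_subset _ _ p3) ht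

lemma card_le_rows_mul {S : Finset (ℕ × ℕ)} {k : ℕ} (h : (cols S).card ≤ k) :
    S.card ≤ k * (rows S).card :=
  (card_le_mul S).trans (Nat.mul_le_mul_right _ h)

/-- The number of blocks of `w ^ 2` columns. -/
lemma blocks_bounds {C q w v : ℕ} (hw : 0 < w) (hv : 0 < v) (hC : C ≤ (w * v) ^ 2)
    (hq : q ≤ (C - 1) / w ^ 2 + 1) : q ≤ v ^ 2 ∧ w ^ 2 * (q - 1) ≤ C - 1 := by
  have hw2 : 0 < w ^ 2 := by positivity
  have hv2 : 0 < v ^ 2 := by positivity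
  constructor
  · have h1 : (C - 1) / w ^ 2 < v ^ 2 := by
      rw [Nat.div_lt_iff_lt_mul hw2]
      rw [show v ^ 2 * w ^ 2 = (w * v) ^ 2 by ring]
      have h3 : 0 < (w * v) ^ 2 := by positivity
      omega
    exact hq.trans h1
  · calc w ^ 2 * (q - 1) ≤ w ^ 2 * ((C - 1) / w ^ 2) := Nat.mul_le_mul_left _ (Nat.sub_le_iff_le_add.2 hq)
      _ ≤ C - 1 := Nat.mul_div_le _ _

/-- First, last and middle parts of a block avoid patterns with linear bounds. First and last parts
cost 2 per global row each, hence the increment 4 per level; middle parts cost 1 per point of the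
contraction, so the coefficient of level `i` is carried over without a factor. -/
lemma VFree.card_le (i j : ℕ) {S : Finset (ℕ × ℕ)} (h : VFree S)
    (hC : (cols S).card ≤ ack i j ^ 2) :
    S.card ≤ (4 + 4 * i) * (rows S).card + 12 * i * j * ((cols S).card - 1) := by
  induction i generalizing j S with
  | zero =>
    rw [ack_zero] at hC
    have := card_le_rows_mul hC
    omega
  | succ i ihi =>
    induction j generalizing S with
    | zero =>
      rw [ack_succ_zero] at hC
      have := card_le_rows_mul hC
      nlinarith
    | succ j ihj =>
      -- At least two columns are needed so that the number of columns is at most twice `D`; this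
      -- turns the `6 = 2 + 2 + 2` per column into `12 * D`.
      rcases Nat.lt_or_ge 1 (cols S).card with hC1 | hC1
      swap
      · have := card_le_rows_mul hC1
        nlinarith [Nat.zero_le ((cols S).card - 1), Nat.zero_le (12 * (i + 1) * (j + 1) *
          ((cols S).card - 1))]
      rw [ack_succ_succ] at hC
      set w := ack (i + 1) j with hw
      have hw0 : 0 < w := ack_pos _ _
      obtain ⟨β, hβ, hk, hq⟩ := exists_blocks S (k := w ^ 2) (by positivity)
      obtain ⟨hq1, hq2⟩ := blocks_bounds hw0 (ack_pos i w) hC (hq _ (globalPart_subset β S))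
      have hT := ihi w ((h.mono (globalPart_subset β S)).contraction hβ) hq1
      rw [rows_contract] at hT
      have hloc := card_le_of_blocks (β := β) (S := localPart β S) (p := 4 + 4 * (i + 1)) (c := 0)
        (e := 12 * (i + 1) * j) fun B => by
          simpa using ihj (h.mono ((block_subset _ _ _).trans (localPart_subset β S)))
            (hk _ (localPart_subset β S) B)
      have hfirst := card_le_of_blocks (β := β) (S := firstPart β S) (p := 2) (c := 2) (e := 0)
        fun B => by simpa using (h.permFree_first hβ B).card_le
      have hlast := card_le_of_blocks (β := β) (S := lastPart β S) (p := 2) (c := 2) (e := 0)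
        fun B => by
          have h1 := (h.hatFree_last hβ B).card_le
          have h2 := card_le_dropTop (block β (lastPart β S) B)
          have h3 := rows_mono (dropTop_subset (block β (lastPart β S) B))
          have h4 := cols_mono (dropTop_subset (block β (lastPart β S) B))
          omega
      have hmid := card_le_of_blocks (β := β) (S := midPart β S) (p := 1) (c := 2) (e := 0)
        fun B => by
          have h1 := (h.ascentFree_mid hβ B).card_le
          have h2 := card_le_dropTop (block β (midPart β S) B)
          have h3 := rows_mono (dropTop_subset (block β (midPart β S) B))
          have h4 := cols_mono (dropTop_subset (block β (midPart β S) B))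
          omega
      have hparts := card_parts β S
      have hR := rows_local_add_global β S
      have k1 := card_contract_local β S
      have k2 := card_contract_first β S
      have k3 := card_contract_last β S
      have k4 := card_contract_mid β S
      have c1 := cols_mono (localPart_subset β S)
      have c2 := cols_mono (firstPart_subset β S)
      have c3 := cols_mono (lastPart_subset β S)
      have c4 := cols_mono (midPart_subset β S)
      set D := (cols S).card - 1 with hD
      -- One factor `w` suffices here; blocks of `w ^ 2` columns are used to match the bound for
      -- `W`, which is quadratic in `j`.
      have hw2 : w * ((cols (contract β (globalPart β S))).card - 1) ≤ D := by
        refine le_trans (Nat.mul_le_mul_right _ ?_) hq2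
        nlinarith
      have e1 : 12 * (i + 1) * j * ((cols (localPart β S)).card - 1) ≤ 12 * (i + 1) * j * D :=
        Nat.mul_le_mul_left _ (by omega)
      have e2 : (4 + 4 * (i + 1)) * (contract β (localPart β S)).card
          ≤ (4 + 4 * (i + 1)) * (rows (localPart β S)).card := Nat.mul_le_mul_left _ k1
      have e3 : 12 * i * w * ((cols (contract β (globalPart β S))).card - 1) ≤ 12 * i * D := by
        rw [mul_assoc]
        exact Nat.mul_le_mul_left _ hw2
      have e4 : (4 + 4 * (i + 1)) * ((rows (localPart β S)).card + (rows (globalPart β S)).card)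
          ≤ (4 + 4 * (i + 1)) * (rows S).card := Nat.mul_le_mul_left _ hR
      have e5 : 12 * (i + 1) * (j + 1) * D = 12 * (i + 1) * j * D + 12 * i * D + 12 * D := by ring
      have e6 : (4 + 4 * (i + 1)) * ((rows (localPart β S)).card + (rows (globalPart β S)).card)
        = (4 + 4 * (i + 1)) * (rows (localPart β S)).card
          + (4 + 4 * i) * (rows (globalPart β S)).card + 4 * (rows (globalPart β S)).card := by ring
      omega

/-! ### The pattern `W` -/

/-- `S` avoids the pattern with columns `d c d b` and rows `b < c < d`. -/
def VMirrorFree (S : Finset (ℕ × ℕ)) : Prop := ∀ b c d y z t u, b < c → c < d → y < z → z < t →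
  t < u → (d, y) ∈ S → (c, z) ∈ S → (d, t) ∈ S → (b, u) ∉ S

lemma VMirrorFree.card_le (i j : ℕ) {S : Finset (ℕ × ℕ)} (h : VMirrorFree S)
    (hC : (cols S).card ≤ ack i j ^ 2) :
    S.card ≤ (4 + 4 * i) * (rows S).card + 12 * i * j * ((cols S).card - 1) := by
  set N := (cols S).sup id with hN
  have hle : ∀ p ∈ S, p.2 ≤ N := fun p hp =>
    Finset.le_sup (f := id) (Finset.mem_image_of_mem Prod.snd hp)
  have hV : VFree (contract (N - ·) S) := by
    intro a c d x y z t h1 h2 h3 h4 h5 p1 p2 p3 p4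
    obtain ⟨x, q1, rfl⟩ := mem_contract.1 p1
    obtain ⟨y, q2, rfl⟩ := mem_contract.1 p2
    obtain ⟨z, q3, rfl⟩ := mem_contract.1 p3
    obtain ⟨t, q4, rfl⟩ := mem_contract.1 p4
    exact h a c d t z y x h1 h2 (by omega) (by omega) (by omega) q4 q3 q2 q1
  have hcols : (cols (contract (N - ·) S)).card ≤ (cols S).card := by
    rw [cols_contract]
    exact Finset.card_image_le
  have hcard : (contract (N - ·) S).card = S.card := by
    refine Finset.card_image_of_injOn ?_
    rintro ⟨r, x⟩ hp ⟨s, y⟩ hq hpq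
    have h1 := hle _ hp
    have h2 := hle _ hq
    simp only [Prod.mk.injEq] at hpq h1 h2 ⊢
    omega
  have := hV.card_le i j (hcols.trans hC)
  rw [hcard, rows_contract] at this
  refine this.trans (Nat.add_le_add_left (Nat.mul_le_mul_left _ ?_) _)
  omega

/-- `S` avoids the pattern with columns `a d c d` and rows `a < c < d` as soon as some nonempty
row lies strictly between `a` and `c`. -/
def GapVFree (S : Finset (ℕ × ℕ)) : Prop := ∀ a b c d x y z t, b ∈ rows S → a < b → b < c → c < d →
  x < y → y < z → z < t → (a, x) ∈ S → (d, y) ∈ S → (c, z) ∈ S → (d, t) ∉ S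

/-- Split the nonempty rows by the parity of their rank. Two rows of equal parity always have a row
between them, so each class is `VFree`. The classes share columns but not rows, so only the column
term doubles. -/
lemma GapVFree.card_le (i j : ℕ) {S : Finset (ℕ × ℕ)} (h : GapVFree S)
    (hC : (cols S).card ≤ ack i j ^ 2) :
    S.card ≤ (4 + 4 * i) * (rows S).card + 24 * i * j * ((cols S).card - 1) := by
  let ρ : ℕ → ℕ := fun r => ((rows S).filter (· < r)).card
  have hgap : ∀ a ∈ rows S, ∀ c, a < c → (Even (ρ a) ↔ Even (ρ c)) →
      ∃ b ∈ rows S, a < b ∧ b < c := by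
    intro a ha c hac hpar
    by_contra! hno
    have h1 : (rows S).filter (· < c) = insert a ((rows S).filter (· < a)) := by
      ext r
      simp only [Finset.mem_filter, Finset.mem_insert]
      constructor
      · rintro ⟨hr, hrc⟩
        rcases lt_trichotomy r a with h2 | h2 | h2
        · exact Or.inr ⟨hr, h2⟩
        · exact Or.inl h2
        · exact absurd hrc (hno r hr h2).not_gt
      · rintro (rfl | ⟨hr, hra⟩)
        · exact ⟨ha, hac⟩
        · exact ⟨hr, hra.trans hac⟩
    have h2 : ρ c = ρ a + 1 := by
      show ((rows S).filter (· < c)).card = _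
      rw [h1, Finset.card_insert_of_notMem (by simp)]
    rw [h2, Nat.even_add_one] at hpar
    tauto
  have hV : ∀ P : ℕ × ℕ → Prop, ∀ _ : DecidablePred P, (∀ p q, P p → P q →
      (Even (ρ p.1) ↔ Even (ρ q.1))) → VFree (S.filter P) := by
    intro P _ hP a c d x y z t h1 h2 h3 h4 h5 p1 p2 p3 p4
    rw [Finset.mem_filter] at p1 p2 p3 p4
    obtain ⟨b, hb, hab, hbc⟩ := hgap a (mem_rows.2 ⟨x, p1.1⟩) c h1 (hP _ _ p1.2 p3.2)
    exact h a b c d x y z t hb hab hbc h2 h3 h4 h5 p1.1 p2.1 p3.1 p4.1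
  have hE := (hV (fun p => Even (ρ p.1)) inferInstance (fun p q hp hq => by tauto)).card_le i j
    ((cols_mono (Finset.filter_subset _ _)).trans hC)
  have hO := (hV (fun p => ¬ Even (ρ p.1)) inferInstance (fun p q hp hq => by tauto)).card_le i j
    ((cols_mono (Finset.filter_subset _ _)).trans hC)
  have hcard := Finset.card_filter_add_card_filter_not (s := S) (fun p => Even (ρ p.1))
  have hrows : (rows (S.filter fun p => Even (ρ p.1))).card
      + (rows (S.filter fun p => ¬ Even (ρ p.1))).card ≤ (rows S).card := by
    rw [← Finset.card_union_of_disjoint]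
    · exact Finset.card_le_card (Finset.union_subset
        (Finset.image_subset_image (Finset.filter_subset _ _))
        (Finset.image_subset_image (Finset.filter_subset _ _)))
    · rw [Finset.disjoint_left]
      intro r h1 h2
      obtain ⟨x, hx⟩ := mem_rows.1 h1
      obtain ⟨y, hy⟩ := mem_rows.1 h2
      exact (Finset.mem_filter.1 hy).2 (Finset.mem_filter.1 hx).2
  have c1 := cols_mono (Finset.filter_subset (fun p => Even (ρ p.1)) S)
  have c2 := cols_mono (Finset.filter_subset (fun p => ¬ Even (ρ p.1)) S)
  have e1 := Nat.mul_le_mul_left (12 * i * j) (Nat.sub_le_sub_right c1 1)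
  have e2 := Nat.mul_le_mul_left (12 * i * j) (Nat.sub_le_sub_right c2 1)
  have e3 := Nat.mul_le_mul_left (4 + 4 * i) hrows
  rw [Nat.mul_add] at e3
  have e4 : 24 * i * j * ((cols S).card - 1) = 12 * i * j * ((cols S).card - 1)
    + 12 * i * j * ((cols S).card - 1) := by ring
  omega

/-- `S` avoids the pattern `W`. -/
def WFree (S : Finset (ℕ × ℕ)) : Prop := ∀ a b c d x y z t u, a < b → b < c → c < d → x < y →
  y < z → z < t → t < u → (a, x) ∈ S → (d, y) ∈ S → (c, z) ∈ S → (d, t) ∈ S → (b, u) ∉ S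

lemma WFree.mono {S T : Finset (ℕ × ℕ)} (h : WFree S) (hT : T ⊆ S) : WFree T :=
  fun a b c d x y z t u h0 h1 h2 h3 h4 h5 h6 p1 p2 p3 p4 p5 =>
    h a b c d x y z t u h0 h1 h2 h3 h4 h5 h6 (hT p1) (hT p2) (hT p3) (hT p4) (hT p5)

lemma WFree.contraction {S : Finset (ℕ × ℕ)} (h : WFree S) {β : ℕ → ℕ} (hβ : Monotone β) :
    WFree (contract β S) := by
  intro a b c d x y z t u h0 h1 h2 h3 h4 h5 h6 p1 p2 p3 p4 p5
  obtain ⟨x, q1, rfl⟩ := mem_contract.1 p1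
  obtain ⟨y, q2, rfl⟩ := mem_contract.1 p2
  obtain ⟨z, q3, rfl⟩ := mem_contract.1 p3
  obtain ⟨t, q4, rfl⟩ := mem_contract.1 p4
  obtain ⟨u, q5, rfl⟩ := mem_contract.1 p5
  exact h a b c d x y z t u h0 h1 h2 (hβ.reflect_lt h3) (hβ.reflect_lt h4) (hβ.reflect_lt h5)
    (hβ.reflect_lt h6) q1 q2 q3 q4 q5

/-- Any row `b` of the first part has a point to the right of the block, which completes `a d c d`
to `W`. -/
lemma WFree.gapVFree_first {S : Finset (ℕ × ℕ)} (h : WFree S) {β : ℕ → ℕ} (hβ : Monotone β)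
    (B : ℕ) : GapVFree (block β (firstPart β S) B) := by
  intro a b c d x y z t hb h0 h1 h2 h3 h4 h5 p1 p2 p3 p4
  obtain ⟨v, hv⟩ := mem_rows.1 hb
  obtain ⟨hv, ev⟩ := mem_block.1 hv
  obtain ⟨p1, -⟩ := mem_block.1 p1
  obtain ⟨p2, -⟩ := mem_block.1 p2
  obtain ⟨p3, -⟩ := mem_block.1 p3
  obtain ⟨p4, e4⟩ := mem_block.1 p4
  obtain ⟨-, -, q⟩ := mem_firstPart.1 hv
  obtain ⟨u, hu, hlt⟩ := exists_after hβ q ev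
  have hs := firstPart_subset β S
  exact h a b c d x y z t u h0 h1 h2 h3 h4 h5 (hlt t e4) (hs p1) (hs p2) (hs p3) (hs p4) hu

/-- The row above that `dropTop` guarantees has a point to the left of the block; it serves as `a`.
-/
lemma WFree.vMirrorFree_last {S : Finset (ℕ × ℕ)} (h : WFree S) {β : ℕ → ℕ} (hβ : Monotone β)
    (B : ℕ) : VMirrorFree (dropTop (block β (lastPart β S) B)) := by
  intro b c d y z t u h1 h2 h4 h5 h6 p2 p3 p4 p5
  obtain ⟨a, x, h0, p1⟩ := exists_above p5
  obtain ⟨p1, e1⟩ := mem_block.1 p1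
  obtain ⟨p2, e2⟩ := mem_block.1 (dropTop_subset _ p2)
  obtain ⟨p3, -⟩ := mem_block.1 (dropTop_subset _ p3)
  obtain ⟨p4, -⟩ := mem_block.1 (dropTop_subset _ p4)
  obtain ⟨p5, -⟩ := mem_block.1 (dropTop_subset _ p5)
  obtain ⟨p1, q1, -⟩ := mem_lastPart.1 p1
  obtain ⟨x', hx, hlt⟩ := exists_before hβ q1 e1
  have hs := lastPart_subset β S
  exact h a b c d x' y z t u h0 h1 h2 (hlt y e2) h4 h5 h6 hx (hs p2) (hs p3) (hs p4) (hs p5)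

/-- The two rows removed by `dropTop` leave room for `a` and `b` above any hat: the upper one is
continued to the left of the block, the lower one to the right. -/
lemma WFree.hatFree_mid {S : Finset (ℕ × ℕ)} (h : WFree S) {β : ℕ → ℕ} (hβ : Monotone β)
    (B : ℕ) : HatFree (dropTop (dropTop (block β (midPart β S) B))) := by
  intro c d y z t h2 h4 h5 p2 p3 p4
  obtain ⟨b, v, h1, p5⟩ := exists_above p3
  obtain ⟨a, x, h0, p1⟩ := exists_above p5
  obtain ⟨p1, e1⟩ := mem_block.1 p1
  obtain ⟨p2, e2⟩ := mem_block.1 (dropTop_subset _ (dropTop_subset _ p2))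
  obtain ⟨p3, -⟩ := mem_block.1 (dropTop_subset _ (dropTop_subset _ p3))
  obtain ⟨p4, e4⟩ := mem_block.1 (dropTop_subset _ (dropTop_subset _ p4))
  obtain ⟨p5, e5⟩ := mem_block.1 (dropTop_subset _ p5)
  obtain ⟨-, q1, -⟩ := mem_midPart.1 p1
  obtain ⟨-, -, q5⟩ := mem_midPart.1 p5
  obtain ⟨x', hx, hlt⟩ := exists_before hβ q1 e1
  obtain ⟨u, hu, hgt⟩ := exists_after hβ q5 e5
  have hs := midPart_subset β S
  exact h a b c d x' y z t u h0 h1 h2 (hlt y e2) h4 h5 (hgt t e4) hx (hs p2) (hs p3) (hs p4) hu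

lemma WFree.card_block_mid {S : Finset (ℕ × ℕ)} (h : WFree S) {β : ℕ → ℕ} (hβ : Monotone β)
    (B : ℕ) : (block β (midPart β S) B).card
      ≤ 2 * (rows (block β (midPart β S) B)).card + 3 * (cols (block β (midPart β S) B)).card := by
  have h1 := (h.hatFree_mid hβ B).card_le
  have h2 := card_le_dropTop (block β (midPart β S) B)
  have h3 := card_le_dropTop (dropTop (block β (midPart β S) B))
  have h4 := rows_mono (dropTop_subset (block β (midPart β S) B))
  have h5 := rows_mono (dropTop_subset (dropTop (block β (midPart β S) B)))
  have h6 := cols_mono (dropTop_subset (block β (midPart β S) B))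
  have h7 := cols_mono (dropTop_subset (dropTop (block β (midPart β S) B)))
  omega

/-- The coefficient of the number of rows. -/
def rowCoeff : ℕ → ℕ
  | 0 => 4
  | i + 1 => 2 * rowCoeff i + 8 + 8 * (i + 1)

/-- The coefficient of the number of columns. -/
def colCoeff : ℕ → ℕ
  | 0 => 0
  | i + 1 => 2 * colCoeff i + 36 * (i + 1) + 8

lemma rowCoeff_add (i : ℕ) : rowCoeff i + (8 * i + 24) = 28 * 2 ^ i := by
  induction i with
  | zero => rfl
  | succ i ih => rw [rowCoeff, pow_succ]; omega

lemma colCoeff_add (i : ℕ) : colCoeff i + (36 * i + 80) = 80 * 2 ^ i := by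
  induction i with
  | zero => rfl
  | succ i ih => rw [colCoeff, pow_succ]; omega

/-- Middle parts contribute twice the contraction, bounded at level `i` with second index `w`; this
is the doubling in `rowCoeff`. First and last parts cost `4 + 4 * (i + 1)` each per global row.
Their column terms are linear in `j` and accumulate over the steps in `j`, hence the factor `j ^ 2`.
-/
lemma WFree.card_le_coeff (i j : ℕ) {S : Finset (ℕ × ℕ)} (h : WFree S)
    (hC : (cols S).card ≤ ack i j ^ 2) :
    S.card ≤ rowCoeff i * (rows S).card + colCoeff i * j ^ 2 * ((cols S).card - 1) := by
  have hcoeff : ∀ i, 1 ≤ rowCoeff i := by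
    intro i
    cases i <;> simp only [rowCoeff] <;> omega
  induction i generalizing j S with
  | zero =>
    rw [ack_zero] at hC
    have := card_le_rows_mul hC
    rw [rowCoeff]
    omega
  | succ i ihi =>
    induction j generalizing S with
    | zero =>
      rw [ack_succ_zero] at hC
      have := card_le_rows_mul hC
      have := Nat.mul_le_mul_right (rows S).card (hcoeff (i + 1))
      omega
    | succ j ihj =>
      rcases Nat.lt_or_ge 1 (cols S).card with hC1 | hC1
      swap
      · have := card_le_rows_mul hC1
        have := Nat.mul_le_mul_right (rows S).card (hcoeff (i + 1))
        omega
      rw [ack_succ_succ] at hC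
      set w := ack (i + 1) j with hw
      have hw0 : 0 < w := ack_pos _ _
      obtain ⟨β, hβ, hk, hq⟩ := exists_blocks S (k := w ^ 2) (by positivity)
      obtain ⟨hq1, hq2⟩ := blocks_bounds hw0 (ack_pos i w) hC (hq _ (globalPart_subset β S))
      have hT := ihi w ((h.mono (globalPart_subset β S)).contraction hβ) hq1
      rw [rows_contract] at hT
      have hloc := card_le_of_blocks (β := β) (S := localPart β S) (p := rowCoeff (i + 1)) (c := 0)
        (e := colCoeff (i + 1) * j ^ 2) fun B => by
          simpa using ihj (h.mono ((block_subset _ _ _).trans (localPart_subset β S)))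
            (hk _ (localPart_subset β S) B)
      have hfirst := card_le_of_blocks (β := β) (S := firstPart β S) (p := 4 + 4 * (i + 1))
        (c := 0) (e := 24 * (i + 1) * j) fun B => by
          simpa using (h.gapVFree_first hβ B).card_le (i + 1) j
            (hk _ (firstPart_subset β S) B)
      have hlast := card_le_of_blocks (β := β) (S := lastPart β S) (p := 4 + 4 * (i + 1))
        (c := 1) (e := 12 * (i + 1) * j) fun B => by
          have h2 := card_le_dropTop (block β (lastPart β S) B)
          have h3 := rows_mono (dropTop_subset (block β (lastPart β S) B))
          have h4 := cols_mono (dropTop_subset (block β (lastPart β S) B))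
          have h1 := (h.vMirrorFree_last hβ B).card_le (i + 1) j
            (h4.trans (hk _ (lastPart_subset β S) B))
          have h5 := Nat.mul_le_mul_left (4 + 4 * (i + 1)) h3
          have h6 := Nat.mul_le_mul_left (12 * (i + 1) * j) (Nat.sub_le_sub_right h4 1)
          omega
      have hmid := card_le_of_blocks (β := β) (S := midPart β S) (p := 2) (c := 3) (e := 0)
        fun B => by simpa using h.card_block_mid hβ B
      have hparts := card_parts β S
      have hR := rows_local_add_global β S
      have k1 := card_contract_local β S
      have k2 := card_contract_first β S
      have k3 := card_contract_last β S
      have k4 := card_contract_mid β S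
      have c1 := cols_mono (localPart_subset β S)
      have c2 := cols_mono (firstPart_subset β S)
      have c3 := cols_mono (lastPart_subset β S)
      have c4 := cols_mono (midPart_subset β S)
      set D := (cols S).card - 1 with hD
      have e1 : colCoeff (i + 1) * j ^ 2 * ((cols (localPart β S)).card - 1)
          ≤ colCoeff (i + 1) * j ^ 2 * D := Nat.mul_le_mul_left _ (by omega)
      have e2 := Nat.mul_le_mul_left (rowCoeff (i + 1)) k1
      have e3 : 24 * (i + 1) * j * ((cols (firstPart β S)).card - 1) ≤ 24 * (i + 1) * j * D :=
        Nat.mul_le_mul_left _ (by omega)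
      have e4 : 12 * (i + 1) * j * ((cols (lastPart β S)).card - 1) ≤ 12 * (i + 1) * j * D :=
        Nat.mul_le_mul_left _ (by omega)
      have e5 : colCoeff i * w ^ 2 * ((cols (contract β (globalPart β S))).card - 1)
          ≤ colCoeff i * D := by
        rw [mul_assoc]
        exact Nat.mul_le_mul_left _ hq2
      have e6 := Nat.mul_le_mul_left (rowCoeff (i + 1)) hR
      have e7 := Nat.mul_le_mul_left (4 + 4 * (i + 1)) k2
      have e8 := Nat.mul_le_mul_left (4 + 4 * (i + 1)) k3
      have e9 : (4 + 4 * (i + 1)) * (rows (globalPart β S)).card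
          + (4 + 4 * (i + 1)) * (rows (globalPart β S)).card
          + 2 * (rowCoeff i * (rows (globalPart β S)).card)
          = rowCoeff (i + 1) * (rows (globalPart β S)).card := by
        rw [rowCoeff]
        ring
      -- From `(j + 1) ^ 2 - j ^ 2 = 2 * j + 1`: the part `2 * j` pays for first and last parts, the
      -- 1 for the contraction and for `8 * D`, which covers the `1 + 3` per column in last and
      -- middle parts.
      have e10 : colCoeff (i + 1) * j ^ 2 * D + 36 * (i + 1) * j * D + 8 * D
          + 2 * (colCoeff i * D) ≤ colCoeff (i + 1) * (j + 1) ^ 2 * D := by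
        have h1 : colCoeff (i + 1) * (j + 1) ^ 2 * D = colCoeff (i + 1) * j ^ 2 * D
          + 2 * (j * D) * colCoeff (i + 1) + D * colCoeff (i + 1) := by ring
        have h2 : 36 * (i + 1) * j * D ≤ 2 * (j * D) * colCoeff (i + 1) := by
          rw [show 36 * (i + 1) * j * D = (j * D) * (36 * (i + 1)) by ring,
            show 2 * (j * D) * colCoeff (i + 1) = (j * D) * (2 * colCoeff (i + 1)) by ring]
          refine Nat.mul_le_mul_left _ ?_
          rw [colCoeff]
          omega
        have h3 : 8 * D + 2 * (colCoeff i * D) ≤ D * colCoeff (i + 1) := by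
          rw [show 8 * D + 2 * (colCoeff i * D) = D * (2 * colCoeff i + 8) by ring]
          refine Nat.mul_le_mul_left _ ?_
          rw [colCoeff]
          omega
        omega
      have e11 : 24 * (i + 1) * j * D + 12 * (i + 1) * j * D = 36 * (i + 1) * j * D := by ring
      rw [Nat.mul_add] at e6
      omega

lemma WFree.card_le (i j : ℕ) {S : Finset (ℕ × ℕ)} (h : WFree S)
    (hC : (cols S).card ≤ ack i j ^ 2) :
    S.card ≤ 2 ^ i * (28 * (rows S).card + 80 * j ^ 2 * (cols S).card) := by
  have h1 := h.card_le_coeff i j hC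
  have h2 : rowCoeff i ≤ 28 * 2 ^ i := by
    rw [← rowCoeff_add]
    omega
  have h3 : colCoeff i ≤ 80 * 2 ^ i := by
    rw [← colCoeff_add]
    omega
  calc S.card ≤ _ := h1
    _ ≤ 28 * 2 ^ i * (rows S).card + 80 * 2 ^ i * j ^ 2 * (cols S).card := by
      gcongr
      omega
    _ = _ := by ring

/-! ### Growth of `ack` and the two-parameter inverse -/

lemma two_le_ack {i j : ℕ} (hj : 1 ≤ j) : 2 ≤ ack i j := by
  induction i generalizing j with
  | zero => simp [ack_zero]
  | succ i ih =>
    obtain ⟨j, rfl⟩ := Nat.exists_eq_add_of_le' hj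
    rw [ack_succ_succ]
    have h1 := ack_pos (i + 1) j
    nlinarith [ih h1]

lemma ack_succ_right_ge (i j : ℕ) : 2 * ack (i + 1) j ≤ ack (i + 1) (j + 1) := by
  rw [ack_succ_succ, mul_comm]
  exact Nat.mul_le_mul_left _ (two_le_ack (ack_pos _ _))

lemma ack_mono_right (i : ℕ) : Monotone (ack i) := by
  refine monotone_nat_of_le_succ fun j => ?_
  cases i with
  | zero => simp [ack_zero]
  | succ i =>
    have := ack_succ_right_ge i j
    omega

lemma two_pow_le_ack (i j : ℕ) : 2 ^ j ≤ ack (i + 1) j := by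
  induction j with
  | zero => simp [ack_succ_zero]
  | succ j ih =>
    have := ack_succ_right_ge i j
    rw [pow_succ]
    omega

lemma ack_two (i : ℕ) : ack i 2 = 2 ^ (i + 1) := by
  induction i with
  | zero => rw [ack_zero]; rfl
  | succ i ih => rw [ack_succ_succ, ack_one_right, ih]; ring

lemma ack_succ_mul_le {i j k : ℕ} (h : k ≤ ack (i + 1) j) :
    ack (i + 1) j * ack i k ≤ ack (i + 1) (j + 1) := by
  rw [ack_succ_succ]
  exact Nat.mul_le_mul_left _ (ack_mono_right i h)

/-- The second index `max {3, ⌈n / m⌉}` in the definition of `alpha`. -/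
def index (n m : ℕ) : ℕ := max 3 ⌈(n : ℚ) / (m : ℚ)⌉₊

lemma three_le_index (n m : ℕ) : 3 ≤ index n m := le_max_left _ _

lemma le_index_mul {n m : ℕ} (hm : 1 ≤ m) : n ≤ index n m * m := by
  have h : (n : ℚ) / m ≤ (index n m : ℚ) :=
    (Nat.le_ceil _).trans (by exact_mod_cast le_max_right _ _)
  rw [div_le_iff₀ (by exact_mod_cast hm)] at h
  exact_mod_cast h

lemma index_mul_le {n m : ℕ} (hm : 1 ≤ m) (h : m ≤ n) : index n m * m ≤ 3 * n := by
  have hm0 : (0 : ℚ) < m := by exact_mod_cast hm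
  have h1 : ⌈(n : ℚ) / m⌉₊ * m ≤ n + m := by
    have h2 := (Nat.ceil_lt_add_one (a := (n : ℚ) / m) (by positivity)).le
    have h3 := mul_le_mul_of_nonneg_right h2 hm0.le
    rw [add_mul, div_mul_cancel₀ _ hm0.ne', one_mul] at h3
    exact_mod_cast h3
  rcases max_choice 3 ⌈(n : ℚ) / (m : ℚ)⌉₊ with h2 | h2
  · rw [index, h2]; omega
  · rw [index, h2]; omega

lemma index_eq_three {n m : ℕ} (hm : 1 ≤ m) (h : n ≤ m) : index n m = 3 := by
  refine max_eq_left ((Nat.ceil_le (n := 3)).2 ?_)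
  rw [div_le_iff₀ (by exact_mod_cast hm)]
  have : (n : ℚ) ≤ m := by exact_mod_cast h
  have : (0 : ℚ) ≤ m := by positivity
  push_cast
  linarith

lemma a_eq_ack' {i j : ℕ} (hi : 1 ≤ i) (hj : 1 ≤ j) : a i j = ack i j := by
  obtain ⟨i, rfl⟩ := Nat.exists_eq_add_of_le' hi
  obtain ⟨j, rfl⟩ := Nat.exists_eq_add_of_le' hj
  exact a_eq_ack i j

lemma alpha_spec (n m : ℕ) : 1 ≤ alpha n m ∧ m ≤ ack (alpha n m) (index n m) := by
  have hJ := three_le_index n m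
  have hne : {i : ℕ | 1 ≤ i ∧ m ≤ a i (index n m)}.Nonempty := by
    refine ⟨m + 1, by omega, ?_⟩
    rw [a_eq_ack' (by omega) (by omega)]
    calc m ≤ 2 ^ (m + 1 + 1) := (Nat.lt_two_pow_self.le).trans (Nat.pow_le_pow_right two_pos (by omega))
      _ = ack (m + 1) 2 := (ack_two _).symm
      _ ≤ _ := ack_mono_right _ (by omega)
  obtain ⟨h1, h2⟩ := Nat.sInf_mem hne
  rw [a_eq_ack' h1 (by omega)] at h2
  exact ⟨h1, h2⟩

lemma ack_lt_of_lt_alpha {n m i : ℕ} (hi : 1 ≤ i) (h : i < alpha n m) :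
    ack i (index n m) < m := by
  have h1 := Nat.notMem_of_lt_sInf h
  have hJ := three_le_index n m
  rw [← a_eq_ack' hi (by omega)]
  by_contra! h2
  exact h1 ⟨hi, h2⟩

/-! ### The upper bound -/

lemma exists_leftmost {S : Finset (ℕ × ℕ)} {r x : ℕ} (h : (r, x) ∈ S) :
    ∃ y ≤ x, (r, y) ∈ S ∧ ¬ HasLeft S (r, y) := by
  obtain ⟨y, hy, hmin⟩ := ((cols S).filter fun y => (r, y) ∈ S).exists_min_image id
    ⟨x, Finset.mem_filter.2 ⟨mem_cols.2 ⟨r, h⟩, h⟩⟩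
  simp only [Finset.mem_filter, id, and_imp, mem_cols] at hy hmin
  exact ⟨y, hmin x ⟨r, h⟩ h, hy.2, fun ⟨z, hz, hlt⟩ => (hmin z ⟨r, hz⟩ hz).not_gt hlt⟩

lemma exists_rightmost {S : Finset (ℕ × ℕ)} {r x : ℕ} (h : (r, x) ∈ S) :
    ∃ y, x ≤ y ∧ (r, y) ∈ S ∧ ¬ HasRight S (r, y) := by
  obtain ⟨y, hy, hmax⟩ := ((cols S).filter fun y => (r, y) ∈ S).exists_max_image id
    ⟨x, Finset.mem_filter.2 ⟨mem_cols.2 ⟨r, h⟩, h⟩⟩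
  simp only [Finset.mem_filter, id, and_imp, mem_cols] at hy hmax
  exact ⟨y, hmax x ⟨r, h⟩ h, hy.2, fun ⟨z, hz, hlt⟩ => (hmax z ⟨r, hz⟩ hz).not_gt hlt⟩

/-- A block map for which the columns in `K` are blocks by themselves. -/
lemma exists_singleton_blocks (K : Finset ℕ) : ∃ β : ℕ → ℕ, Monotone β ∧
    (∀ x, β x < 2 * K.card + 1) ∧ ∀ x ∈ K, ∀ y, β x = β y → x = y := by
  let ρ : ℕ → ℕ := fun x => (K.filter (· < x)).card
  have hmono : Monotone ρ := fun x y hxy => Finset.card_le_card fun z hz => by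
    simp only [Finset.mem_filter] at hz ⊢
    exact ⟨hz.1, hz.2.trans_le hxy⟩
  have hstrict : ∀ x ∈ K, ∀ y, x < y → ρ x < ρ y := by
    intro x hx y hxy
    refine Finset.card_lt_card ⟨fun z hz => ?_, fun h => ?_⟩
    · simp only [Finset.mem_filter] at hz ⊢
      exact ⟨hz.1, hz.2.trans hxy⟩
    · have := h (Finset.mem_filter.2 ⟨hx, hxy⟩)
      simp at this
  have hlt : ∀ x ∈ K, ρ x < K.card := by
    intro x hx
    refine Finset.card_lt_card ⟨Finset.filter_subset _ _, fun h => ?_⟩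
    have := h hx
    simp at this
  have hle : ∀ x, ρ x ≤ K.card := fun x => Finset.card_le_card (Finset.filter_subset _ _)
  -- Columns in `K` get odd numbers, the gaps between them even ones.
  refine ⟨fun x => 2 * ρ x + if x ∈ K then 1 else 0, ?_, ?_, ?_⟩
  · intro x y hxy
    rcases hxy.eq_or_lt with rfl | hxy
    · exact le_rfl
    · have h1 := hmono hxy.le
      have h2 := hstrict x
      by_cases hx : x ∈ K
      · have := h2 hx y hxy
        simp only [hx, if_true]
        omega
      · simp only [hx, if_false]
        omega
  · intro x
    by_cases hx : x ∈ K
    · have := hlt x hx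
      simp only [hx, if_true]
      omega
    · have := hle x
      simp only [hx, if_false]
      omega
  · intro x hx y hxy
    have hy : y ∈ K := by
      by_contra hy
      simp only [hx, hy, if_true, if_false] at hxy
      omega
    simp only [hx, hy, if_true] at hxy
    rcases lt_trichotomy x y with h | h | h
    · have := hstrict x hx y h
      omega
    · exact h
    · have := hstrict y hy x h
      omega

/-- Reduces wide matrices to `O(n)` columns. Columns holding the first or last point of a row, at
most two per row, become blocks by themselves. Each row then has only one point in its first and one
in its last block, and the middle blocks are controlled by the hat. -/
lemma WFree.exists_contraction {S : Finset (ℕ × ℕ)} (h : WFree S) : ∃ T : Finset (ℕ × ℕ),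
    WFree T ∧ (rows T).card ≤ (rows S).card ∧ (cols T).card ≤ 4 * (rows S).card + 1 ∧
      S.card ≤ 2 * (rows S).card + 3 * (cols S).card + 2 * T.card := by
  classical
  set K := cols (S.filter fun p => ¬ HasLeft S p) ∪ cols (S.filter fun p => ¬ HasRight S p) with hK
  have hKcard : K.card ≤ 2 * (rows S).card := by
    have h1 : (S.filter fun p => ¬ HasLeft S p).card ≤ (rows S).card := by
      refine card_le_rows_of_unique (Finset.filter_subset _ _) fun r x y hx hy hxy => ?_
      rw [Finset.mem_filter] at hx hy
      exact hy.2 ⟨x, hx.1, hxy⟩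
    have h2 : (S.filter fun p => ¬ HasRight S p).card ≤ (rows S).card := by
      refine card_le_rows_of_unique (Finset.filter_subset _ _) fun r x y hx hy hxy => ?_
      rw [Finset.mem_filter] at hx hy
      exact hx.2 ⟨y, hy.1, hxy⟩
    have h3 : K.card ≤ _ + _ := Finset.card_union_le _ _
    have h4 : (cols (S.filter fun p => ¬ HasLeft S p)).card ≤ _ := Finset.card_image_le
    have h5 : (cols (S.filter fun p => ¬ HasRight S p)).card ≤ _ := Finset.card_image_le
    omega
  obtain ⟨β, hβ, hlt, hsing⟩ := exists_singleton_blocks K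
  have hleft : (S.filter fun p => ¬ BlockLeft β S p).card ≤ (rows S).card := by
    refine card_le_rows_of_unique (Finset.filter_subset _ _) fun r x y hx hy hxy => ?_
    rw [Finset.mem_filter] at hx hy
    obtain ⟨z, hzx, hz, hzl⟩ := exists_leftmost hx.1
    refine hy.2 ⟨z, hz, lt_of_le_of_ne (hβ (by simp only; omega)) fun he => ?_⟩
    have := hsing z (Finset.mem_union_left _ (mem_cols.2 ⟨r, Finset.mem_filter.2 ⟨hz, hzl⟩⟩)) y he
    omega
  have hright : (lastPart β S).card ≤ (rows S).card := by
    refine card_le_rows_of_unique (lastPart_subset β S) fun r x y hx hy hxy => ?_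
    rw [mem_lastPart] at hx hy
    obtain ⟨z, hyz, hz, hzl⟩ := exists_rightmost hy.1
    refine hx.2.2 ⟨z, hz, lt_of_le_of_ne (hβ (by simp only; omega)) fun he => ?_⟩
    have := hsing z (Finset.mem_union_right _ (mem_cols.2 ⟨r, Finset.mem_filter.2 ⟨hz, hzl⟩⟩)) x
      he.symm
    omega
  have hmid := card_le_of_blocks (β := β) (S := midPart β S) (p := 2) (c := 3) (e := 0)
    fun B => by simpa using h.card_block_mid hβ B
  refine ⟨contract β S, h.contraction hβ, (rows_contract β S).symm ▸ le_rfl, ?_, ?_⟩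
  · rw [cols_contract]
    calc _ ≤ (Finset.range (2 * K.card + 1)).card := by
          refine Finset.card_le_card fun B hB => ?_
          obtain ⟨x, -, rfl⟩ := Finset.mem_image.1 hB
          exact Finset.mem_range.2 (hlt x)
      _ ≤ _ := by rw [Finset.card_range]; omega
  · have h1 := Finset.card_filter_add_card_filter_not (s := S) (BlockLeft β S)
    have h2 := Finset.card_filter_add_card_filter_not (s := S.filter (BlockLeft β S))
      (BlockRight β S)
    rw [Finset.filter_filter, Finset.filter_filter] at h2
    have h3 : (contract β (midPart β S)).card ≤ (contract β S).card :=
      Finset.card_le_card (Finset.image_subset_image (midPart_subset β S))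
    have h4 := cols_mono (midPart_subset β S)
    have h5 : (midPart β S).card
      = (S.filter fun p => BlockLeft β S p ∧ BlockRight β S p).card := by
      unfold midPart; congr
    have h6 : (lastPart β S).card
      = (S.filter fun p => BlockLeft β S p ∧ ¬ BlockRight β S p).card := by
      unfold lastPart; congr
    omega

/-- Replaces the index `J` by a logarithmic one, whose square is only `O(J)`. -/
lemma exists_log_index (J : ℕ) (hJ : 1 ≤ J) : ∃ k, J ≤ 2 ^ k ∧ (k + 1) ^ 2 ≤ 9 * J := by
  have h : ∀ l : ℕ, (l + 2) ^ 2 + 1 ≤ 9 * 2 ^ l := by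
    intro l
    induction l with
    | zero => norm_num
    | succ l ih =>
      have h1 : (l + 1 + 2) ^ 2 + 1 + (l ^ 2 + 2 * l) = 2 * ((l + 2) ^ 2 + 1) := by ring
      rw [pow_succ 2 l]
      omega
  refine ⟨Nat.log 2 J + 1, (Nat.lt_pow_succ_log_self one_lt_two J).le, ?_⟩
  have h1 := Nat.pow_log_le_self 2 (show J ≠ 0 by omega)
  have h2 := h (Nat.log 2 J)
  rw [show Nat.log 2 J + 1 + 1 = Nat.log 2 J + 2 by ring]
  omega

lemma WFree.card_le_alpha {n m : ℕ} (hn : 1 ≤ n) (hm : 1 ≤ m) {S : Finset (ℕ × ℕ)} (h : WFree S)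
    (hR : (rows S).card ≤ n) (hC : (cols S).card ≤ m) :
    S.card ≤ 7258 * (m + n * 2 ^ alpha n m) := by
  obtain ⟨hα, hmα⟩ := alpha_spec n m
  set α := alpha n m with hαdef
  have hpos : 1 ≤ 2 ^ α := Nat.one_le_two_pow
  rcases le_or_gt n m with hnm | hnm
  · rw [index_eq_three hm hnm] at hmα
    obtain ⟨T, hT, hTR, hTC, hST⟩ := h.exists_contraction
    have h8 : 8 ≤ ack α 3 := by
      obtain ⟨i, hi⟩ := Nat.exists_eq_add_of_le' hα
      rw [hi]
      exact two_pow_le_ack i 3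
    -- With `A = ack α 3 ≥ 8` and `n ≤ m ≤ A`, there are at most `4 * A + 1 ≤ A ^ 2` columns. The
    -- final constant is `7258 = 2 * 3628 + 2`.
    have hbound := hT.card_le α 3 (hTC.trans (by nlinarith))
    have h1 : 2 ^ α * (28 * (rows T).card + 80 * 3 ^ 2 * (cols T).card) ≤ 2 ^ α * (3628 * n) :=
      Nat.mul_le_mul_left _ (by omega)
    have h2 : n ≤ n * 2 ^ α := Nat.le_mul_of_pos_right _ hpos
    have h3 : 2 ^ α * (3628 * n) = 3628 * (n * 2 ^ α) := by ring
    omega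
  · obtain ⟨k, hk1, hk2⟩ := exists_log_index (index n m) (by have := three_le_index n m; omega)
    -- At level `α` the column term would be of order `index n m ^ 2 * m`, too large. One level
    -- higher, at the cost of a factor 2, the index `k + 1` suffices and the column term is `O(n)`.
    have h1 : m ≤ ack (α + 1) (k + 1) := by
      have h2 := ack_succ_mul_le (i := α) (hk1.trans (two_pow_le_ack α k))
      have h3 := ack_pos (α + 1) k
      nlinarith
    have hbound := h.card_le (α + 1) (k + 1) (hC.trans (by nlinarith))
    have h2 : 80 * (k + 1) ^ 2 * (cols S).card ≤ 80 * (27 * n) := by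
      have h3 := index_mul_le hm hnm.le
      have h4 : (k + 1) ^ 2 * (cols S).card ≤ 9 * index n m * m := Nat.mul_le_mul hk2 hC
      rw [mul_assoc]
      refine Nat.mul_le_mul_left _ (h4.trans ?_)
      rw [mul_assoc]
      omega
    have h3 : 2 ^ (α + 1) * (28 * (rows S).card + 80 * (k + 1) ^ 2 * (cols S).card)
        ≤ 2 ^ (α + 1) * (2188 * n) := Nat.mul_le_mul_left _ (by omega)
    have h4 : 2 ^ (α + 1) * (2188 * n) = 4376 * (n * 2 ^ α) := by ring
    omega

/-! ### From point sets back to matrices -/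

/-- The point set of a matrix. -/
def points {n m : ℕ} (A : Mat n m) : Finset (ℕ × ℕ) :=
  (Finset.univ.filter fun p : Fin n × Fin m => A p.1 p.2 = true).image
    fun p => ((p.1 : ℕ), (p.2 : ℕ))

lemma mem_points {n m : ℕ} {A : Mat n m} {r x : ℕ} : (r, x) ∈ points A ↔
    ∃ (i : Fin n) (j : Fin m), A i j = true ∧ (i : ℕ) = r ∧ (j : ℕ) = x := by
  simp [points, Finset.mem_image]

lemma card_points {n m : ℕ} (A : Mat n m) : (points A).card = weight A := by
  refine Finset.card_image_of_injective _ ?_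
  rintro ⟨i, j⟩ ⟨i', j'⟩ h
  simpa [Prod.ext_iff, Fin.ext_iff] using h

lemma strictMono_vec {n k : ℕ} {f : Fin (k + 1) → Fin n}
    (h : ∀ i : Fin k, f i.castSucc < f i.succ) : StrictMono f :=
  Fin.strictMono_iff_lt_succ.2 h

lemma contains_W {n m : ℕ} {A : Mat n m} {a b c d : Fin n} {x y z t u : Fin m} (h0 : a < b)
    (h1 : b < c) (h2 : c < d) (h3 : x < y) (h4 : y < z) (h5 : z < t) (h6 : t < u)
    (p1 : A a x = true) (p2 : A d y = true) (p3 : A c z = true) (p4 : A d t = true)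
    (p5 : A b u = true) : Contains W A := by
  refine ⟨![a, b, c, d], ![x, y, z, t, u], strictMono_vec ?_, strictMono_vec ?_, ?_⟩
  · intro i
    fin_cases i <;> simpa
  · intro i
    fin_cases i <;> simpa
  · intro i j hij
    fin_cases i <;> fin_cases j <;> first | (simp [W] at hij; done) | assumption

lemma wFree_points {n m : ℕ} {A : Mat n m} (h : ¬ Contains W A) : WFree (points A) := by
  intro a b c d x y z t u h0 h1 h2 h3 h4 h5 h6 p1 p2 p3 p4 p5
  obtain ⟨a, x, q1, rfl, rfl⟩ := mem_points.1 p1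
  obtain ⟨d, y, q2, rfl, rfl⟩ := mem_points.1 p2
  obtain ⟨c, z, q3, rfl, rfl⟩ := mem_points.1 p3
  obtain ⟨d', t, q4, hd, rfl⟩ := mem_points.1 p4
  obtain ⟨b, u, q5, rfl, rfl⟩ := mem_points.1 p5
  obtain rfl := Fin.ext hd
  exact h (contains_W h0 h1 h2 h3 h4 h5 h6 q1 q2 q3 q4 q5)

lemma Ex_W_le {n m : ℕ} (hn : 1 ≤ n) (hm : 1 ≤ m) :
    Ex W n m ≤ 7258 * (m + n * 2 ^ alpha n m) := by
  classical
  refine Finset.sup_le fun A hA => ?_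
  rw [← card_points]
  refine (wFree_points (Finset.mem_filter.1 hA).2).card_le_alpha hn hm ?_ ?_
  · calc _ ≤ (Finset.range n).card := Finset.card_le_card fun r hr => by
          obtain ⟨x, hx⟩ := mem_rows.1 hr
          obtain ⟨i, -, -, rfl, -⟩ := mem_points.1 hx
          simp
      _ = n := Finset.card_range n
  · calc _ ≤ (Finset.range m).card := Finset.card_le_card fun x hx => by
          obtain ⟨r, hx⟩ := mem_cols.1 hx
          obtain ⟨-, j, -, -, rfl⟩ := mem_points.1 hx
          simp
      _ = m := Finset.card_range m

/-! ### Recursive construction of dense matrices -/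

/-- The property maintained by the construction; `ρ` is the height of a row (larger is higher) and
`γ` is the position of a column. It implies that the matrix does not contain `W`. -/
def Sparse {R C K L : Type*} [LinearOrder K] [LinearOrder L] (ρ : R → K) (γ : C → L)
    (A : R → C → Prop) : Prop :=
  ∀ a b c d x y z t u, ρ d < ρ c → ρ c < ρ b → ρ b ≤ ρ a → γ x ≤ γ y → γ y ≤ γ z → γ z ≤ γ t →
    γ y < γ t → γ t ≤ γ u → A a x → A d y → A c z → A d t → ¬ A b u

/-- There is a sparse matrix with `n` rows and `s` columns with `j` 1s in each column. -/
def Config (n s j : ℕ) : Prop :=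
  ∃ A : Fin n → Fin s → Prop, Sparse id id A ∧ ∀ x, Nat.card {r // A r x} = j

/-- Allows constructions on arbitrary finite index types, ordered by injective keys such as
lexicographic ones. -/
lemma Config.of_keys {R C K L : Type*} [Fintype R] [Fintype C] [LinearOrder K] [LinearOrder L]
    {ρ : R → K} {γ : C → L} {A : R → C → Prop} (hρ : Function.Injective ρ)
    (hγ : Function.Injective γ) (h : Sparse ρ γ A) {n s j : ℕ} (hn : Fintype.card R = n)
    (hs : Fintype.card C = s) (hj : ∀ x, Nat.card {r // A r x} = j) : Config n s j := by
  let _ : LinearOrder R := LinearOrder.lift' ρ hρ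
  let _ : LinearOrder C := LinearOrder.lift' γ hγ
  let e : Fin n ≃o R := Fintype.orderIsoFinOfCardEq R hn
  let f : Fin s ≃o C := Fintype.orderIsoFinOfCardEq C hs
  refine ⟨fun r x => A (e r) (f x), ?_, fun x => ?_⟩
  · intro a b c d x y z t u h1 h2 h3 h4 h5 h6 h7 h8
    exact h (e a) (e b) (e c) (e d) (f x) (f y) (f z) (f t) (f u) (e.lt_iff_lt.2 h1)
      (e.lt_iff_lt.2 h2) (e.le_iff_le.2 h3) (f.le_iff_le.2 h4) (f.le_iff_le.2 h5)
      (f.le_iff_le.2 h6) (f.lt_iff_lt.2 h7) (f.le_iff_le.2 h8)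
  · rw [← hj (f x)]
    exact Nat.card_congr (e.toEquiv.subtypeEquiv fun r => Iff.rfl)

lemma Config.single_column (j : ℕ) : Config j 1 j := by
  refine ⟨fun _ _ => True, ?_, fun x => ?_⟩
  · intro a b c d x y z t u _ _ _ _ _ _ h
    exact absurd h (by simp [Subsingleton.elim y t])
  · simp

lemma Config.no_rows (s : ℕ) : Config 0 s 0 :=
  ⟨fun _ _ => True, fun a => a.elim0, fun x => by simp⟩

lemma lex_le_iff {α β : Type*} [LinearOrder α] [LinearOrder β] {x y : α × β} :
    toLex x ≤ toLex y ↔ x.1 < y.1 ∨ x.1 = y.1 ∧ x.2 ≤ y.2 := Prod.Lex.toLex_le_toLex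

lemma lex_lt_iff {α β : Type*} [LinearOrder α] [LinearOrder β] {x y : α × β} :
    toLex x < toLex y ↔ x.1 < y.1 ∨ x.1 = y.1 ∧ x.2 < y.2 := Prod.Lex.toLex_lt_toLex

/-- The copies ascend to the right, while in a forbidden configuration the leftmost point `a` is
also highest; this forces all points into one copy. -/
lemma Config.copies {n s j : ℕ} (h : Config n s j) (k : ℕ) : Config (k * n) (k * s) j := by
  obtain ⟨A, hA, hj⟩ := h
  refine Config.of_keys (R := Fin k × Fin n) (C := Fin k × Fin s) (ρ := toLex) (γ := toLex)
    (A := fun r x => r.1 = x.1 ∧ A r.2 x.2) toLex.injective toLex.injective ?_ (by simp) (by simp)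
    fun x => ?_
  · rintro ⟨a1, a⟩ ⟨b1, b⟩ ⟨c1, c⟩ ⟨d1, d⟩ ⟨x1, x⟩ ⟨y1, y⟩ ⟨z1, z⟩ ⟨t1, t⟩ ⟨u1, u⟩
    simp only [lex_lt_iff, lex_le_iff]
    rintro h1 h2 h3 h4 h5 h6 h7 h8 ⟨rfl, p1⟩ ⟨rfl, p2⟩ ⟨rfl, p3⟩ ⟨rfl, p4⟩ ⟨rfl, p5⟩
    have e1 : c1 = d1 := by omega
    subst e1
    have e2 : a1 = c1 := by omega
    subst e2
    have e3 : b1 = a1 := by omega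
    subst e3
    simp only [lt_self_iff_false, true_and, false_or] at h1 h2 h3 h4 h5 h6 h7 h8
    exact hA a b c d x y z t u h1 h2 h3 h4 h5 h6 h7 h8 p1 p2 p3 p4 p5
  · rw [← hj x.2]
    refine Nat.card_congr ⟨fun r => ⟨r.1.2, r.2.2⟩, fun r => ⟨(x.1, r.1), rfl, r.2⟩, ?_, ?_⟩
    · rintro ⟨⟨r1, r⟩, h1, h2⟩
      obtain rfl : r1 = x.1 := h1
      rfl
    · intro r
      rfl

section compose

variable {nO sO nI w : ℕ}

/-- The half blocks of columns of the composed matrix. -/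
abbrev Half (sO : ℕ) := Lex (Fin sO × Bool)

/-- The height of a row of the composed matrix: the rows of an inner matrix are inserted just above
the row `top B` of the outer matrix. -/
def height (top : Fin sO → Fin nO) :
    Fin nO ⊕ Half sO × Fin nI → Lex (Fin nO × WithBot (Lex (Half sO × Fin nI)))
  | .inl r => toLex (r, ⊥)
  -- Inner rows inserted at the same outer row are ordered by half block, so copies further right
  -- lie higher.
  | .inr l => toLex (top (ofLex l.1).1, ((toLex l : Lex (Half sO × Fin nI)) : WithBot _))

/-- The composition of an outer and an inner matrix: each outer 1 becomes a 1 in both half blocks,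
at the position `pos`. -/
def compose (O : Fin nO → Fin sO → Prop) (I : Fin nI → Fin w → Prop)
    (pos : Fin sO → Bool → Fin nO → Fin w) : Fin nO ⊕ Half sO × Fin nI → Half sO × Fin w → Prop
  | .inl r, x => O r (ofLex x.1).1 ∧ x.2 = pos (ofLex x.1).1 (ofLex x.1).2 r
  | .inr l, x => l.1 = x.1 ∧ I l.2 x.2

variable {top : Fin sO → Fin nO}

lemma height_injective : Function.Injective (height (nI := nI) top) := by
  rintro (r | l) (r' | l') h
  · simpa [height] using h
  · simp [height] at h
  · simp [height] at h
  · simp only [height, EmbeddingLike.apply_eq_iff_eq, Prod.mk.injEq, WithBot.coe_inj] at h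
    rw [h.2]

lemma height_inl_lt {r r' : Fin nO} :
    height (nI := nI) top (.inl r) < height top (.inl r') ↔ r < r' := by
  simp [height, lex_lt_iff]

lemma height_inl_le {r r' : Fin nO} :
    height (nI := nI) top (.inl r) ≤ height top (.inl r') ↔ r ≤ r' := by
  simp [height, lex_le_iff, ← le_iff_lt_or_eq]

lemma height_inl_le_inr {r : Fin nO} {l : Half sO × Fin nI} :
    height top (.inl r) ≤ height top (.inr l) ↔ r ≤ top (ofLex l.1).1 := by
  simp [height, lex_le_iff, ← le_iff_lt_or_eq]

lemma height_inr_le_inl {r : Fin nO} {l : Half sO × Fin nI} :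
    height top (.inr l) ≤ height top (.inl r) ↔ top (ofLex l.1).1 < r := by
  simp [height, lex_le_iff]

lemma half_mono {p q : Half sO} (h : p ≤ q) : (ofLex p).1 ≤ (ofLex q).1 := by
  rcases Prod.Lex.le_iff.1 h with h | h
  · exact h.le
  · exact h.1.le

lemma height_inr_lt (htop : Monotone top) {l l' : Half sO × Fin nI} :
    height top (.inr l) < height top (.inr l') ↔ l.1 < l'.1 ∨ l.1 = l'.1 ∧ l.2 < l'.2 := by
  simp only [height, lex_lt_iff, WithBot.coe_lt_coe]
  constructor
  · rintro (h | h)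
    · left
      by_contra! hle
      exact (htop (half_mono hle)).not_gt h
    · exact h.2
  · intro h
    have hle : top (ofLex l.1).1 ≤ top (ofLex l'.1).1 := by
      rcases h with h | h
      · exact htop (half_mono h.le)
      · rw [h.1]
    rcases hle.lt_or_eq with h1 | h1
    · exact Or.inl h1
    · exact Or.inr ⟨h1, h⟩

lemma height_inr_le (htop : Monotone top) {l l' : Half sO × Fin nI} :
    height top (.inr l) ≤ height top (.inr l') ↔ l.1 < l'.1 ∨ l.1 = l'.1 ∧ l.2 ≤ l'.2 := by
  rw [← not_lt, height_inr_lt htop]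
  rcases lt_trichotomy l.1 l'.1 with h | h | h
  · simp [h, h.not_gt, h.ne']
  · simp [h]
  · simp [h, h.not_gt, h.ne']

variable {O : Fin nO → Fin sO → Prop} {I : Fin nI → Fin w → Prop}
  {pos : Fin sO → Bool → Fin nO → Fin w}

/-- The staircase property: outer 1s up to a half block lie below its inner rows, and inner copies
further left lie lower still. -/
lemma eq_inr_of_le (htop : Monotone top) (hmax : ∀ B r, O r B → r ≤ top B)
    {l : Half sO × Fin nI} {s : Fin nO ⊕ Half sO × Fin nI} {x : Half sO × Fin w}
    (hs : height top (.inr l) ≤ height top s) (hx : compose O I pos s x) (hle : x.1 ≤ l.1) :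
    ∃ k, s = .inr (l.1, k) ∧ x.1 = l.1 := by
  rcases s with r | l'
  · rw [height_inr_le_inl] at hs
    have h1 := hmax _ _ hx.1
    have h2 := htop (half_mono hle)
    exact absurd (hs.trans_le (h1.trans h2)) (lt_irrefl _)
  · rw [height_inr_le htop] at hs
    have h1 : l'.1 = x.1 := hx.1
    have h2 : x.1 = l.1 := by
      refine le_antisymm hle ?_
      rw [← h1]
      rcases hs with h | h
      · exact h.le
      · exact h.1.le
    exact ⟨l'.2, by rw [← h2, ← h1], h2⟩

lemma eq_inr_of_between (htop : Monotone top) {p : Half sO} {i k : Fin nI}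
    {s : Fin nO ⊕ Half sO × Fin nI} (h1 : height top (.inr (p, i)) ≤ height top s)
    (h2 : height top s ≤ height top (.inr (p, k))) : ∃ l, s = .inr (p, l) := by
  rcases s with r | ⟨q, l⟩
  · rw [height_inr_le_inl] at h1
    rw [height_inl_le_inr] at h2
    exact absurd (h1.trans_le h2) (lt_irrefl _)
  · rw [height_inr_le htop] at h1 h2
    refine ⟨l, ?_⟩
    have : p = q := le_antisymm (h1.elim le_of_lt fun h => h.1.le) (h2.elim le_of_lt fun h => h.1.le)
    rw [this]

/-- If `d` is an inner row, the whole configuration falls into that inner copy. If `d` is outer, the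
staircase makes `b` and `c` outer as well, and the configuration projects to the outer matrix. The
projection may merge columns, and an inner `a` is replaced by `top`, which may equal `b`; hence the
weak inequalities in `Sparse`. The remaining case, both points of `d` from one outer 1, is excluded
by the opposite orders in the two halves. -/
lemma sparse_compose (hO : Sparse id id O) (hI : Sparse id id I)
    (hmax : ∀ B r x, x ≤ B → O r x → r ≤ top B) (hex : ∀ B, ∃ x ≤ B, O (top B) x)
    (hpos : ∀ B r r', O r B → O r' B → r < r' →
      pos B true r < pos B true r' ∧ pos B false r' < pos B false r) :
    Sparse (height top) toLex (compose O I pos) := by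
  have htop : Monotone top := fun B B' h => by
    obtain ⟨x, hx, hOx⟩ := hex B
    exact hmax B' _ x (hx.trans h) hOx
  have hmax' : ∀ B r, O r B → r ≤ top B := fun B r => hmax B r B le_rfl
  have fst_le : ∀ {x y : Half sO × Fin w}, toLex x ≤ toLex y → x.1 ≤ y.1 := fun h =>
    (lex_le_iff.1 h).elim le_of_lt fun h => h.1.le
  have snd_le : ∀ {x y : Half sO × Fin w}, toLex x ≤ toLex y → x.1 = y.1 → x.2 ≤ y.2 := fun h he =>
    (lex_le_iff.1 h).elim (fun h => absurd he h.ne) fun h => h.2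
  intro a b c d x y z t u h1 h2 h3 h4 h5 h6 h7 h8 pa pd pc pd' pb
  have g4 := fst_le h4
  have g5 := fst_le h5
  have g6 := fst_le h6
  have g8 := fst_le h8
  rcases d with d | ⟨p, d⟩
  swap
  · obtain ⟨ey : p = y.1, pd⟩ := pd
    obtain ⟨et : p = t.1, pd'⟩ := pd'
    obtain ⟨c, rfl, ez⟩ := eq_inr_of_le htop hmax' h1.le pc (g6.trans_eq et.symm)
    obtain ⟨a, rfl, ex⟩ := eq_inr_of_le htop hmax' ((h1.trans h2).le.trans h3) pa
      (g4.trans_eq ey.symm)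
    simp only at ex ez
    obtain ⟨b, rfl⟩ := eq_inr_of_between htop h2.le h3
    obtain ⟨eu : p = u.1, pb⟩ := pb
    rw [height_inr_lt htop] at h1 h2
    rw [height_inr_le htop] at h3
    simp only [lt_self_iff_false, true_and, false_or] at h1 h2 h3
    have h7' : y.2 < t.2 := (lex_lt_iff.1 h7).elim (fun h => absurd (ey.symm.trans et) h.ne)
      fun h => h.2
    exact hI a b c d x.2 y.2 z.2 t.2 u.2 h1 h2 h3 (snd_le h4 (ex.trans ey))
      (snd_le h5 (ey.symm.trans ez.symm)) (snd_le h6 (ez.trans et)) h7'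
      (snd_le h8 (et.symm.trans eu)) pa.2 pd pc.2 pd' pb
  obtain ⟨hdy, ey⟩ := pd
  obtain ⟨hdt, et⟩ := pd'
  have once : y.1 ≠ t.1 := by
    intro he
    refine h7.ne ?_
    rw [show y = t from Prod.ext he (by rw [ey, et, he])]
  rcases b with b | ⟨p, b⟩
  swap
  · obtain ⟨eu : p = u.1, pb⟩ := pb
    obtain ⟨a, rfl, ex⟩ := eq_inr_of_le htop hmax' h3 pa
      ((g4.trans (g5.trans (g6.trans g8))).trans_eq eu.symm)
    refine once (le_antisymm (g5.trans g6) ?_)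
    calc t.1 ≤ u.1 := g8
      _ = x.1 := eu.symm.trans ex.symm
      _ ≤ y.1 := g4
  rcases c with c | ⟨p, c⟩
  swap
  · obtain ⟨ez : p = z.1, pc⟩ := pc
    obtain ⟨a, rfl, ex⟩ := eq_inr_of_le htop hmax' (h2.le.trans h3) pa
      ((g4.trans g5).trans_eq ez.symm)
    obtain ⟨b', hb⟩ := eq_inr_of_between htop h2.le h3
    simp at hb
  rw [height_inl_lt] at h1 h2
  obtain ⟨hcz, ez⟩ := pc
  obtain ⟨hbu, -⟩ := pb
  have k4 := half_mono g4
  have k5 := half_mono g5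
  have k6 := half_mono g6
  have k8 := half_mono g8
  obtain ⟨a0, x0, ha0, hx0, hO0⟩ : ∃ a0 x0, b ≤ a0 ∧ x0 ≤ (ofLex x.1).1 ∧ O a0 x0 := by
    rcases a with a | ⟨p, a⟩
    · exact ⟨a, _, height_inl_le.1 h3, le_rfl, pa.1⟩
    · obtain ⟨ex : p = x.1, -⟩ := pa
      obtain ⟨x0, hx0, hO0⟩ := hex (ofLex p).1
      rw [ex] at hx0 hO0
      rw [height_inl_le_inr, ex] at h3
      exact ⟨_, x0, h3, hx0, hO0⟩
  rcases (k5.trans k6).lt_or_eq with hlt | heq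
  · exact hO a0 b c d x0 _ _ _ _ h1 h2 ha0 (hx0.trans k4) k5 k6 hlt k8 hO0 hdy hcz hdt hbu
  -- Now `d` is met once in the left and once in the right half of one outer column. The higher row
  -- `c` lies left of `d` in the left half and right of `d` in the right half, so never between.
  have hzy : (ofLex z.1).1 = (ofLex y.1).1 := le_antisymm (k6.trans_eq heq.symm) k5
  rw [hzy] at hcz ez
  rw [← heq] at et
  obtain ⟨q1, q2⟩ := hpos _ _ _ hdy hcz h1
  have hne : (ofLex y.1).2 ≠ (ofLex t.1).2 := fun he =>
    once (ofLex.injective (Prod.ext heq he))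
  have hle : (ofLex y.1).2 ≤ (ofLex t.1).2 := by
    rcases Prod.Lex.le_iff.1 (g5.trans g6) with h | h
    · exact absurd heq h.ne
    · exact h.2
  have hyf : (ofLex y.1).2 = false := by
    revert hne hle
    cases (ofLex y.1).2 <;> cases (ofLex t.1).2 <;> simp
  have htt : (ofLex t.1).2 = true := by
    revert hne hle
    cases (ofLex y.1).2 <;> cases (ofLex t.1).2 <;> simp
  cases hz : (ofLex z.1).2 with
  | false =>
    have := snd_le h5 (ofLex.injective (Prod.ext hzy.symm (hyf.trans hz.symm)))
    rw [ey, ez, hyf, hz] at this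
    exact this.not_gt q2
  | true =>
    have := snd_le h6 (ofLex.injective (Prod.ext (hzy.trans heq) (hz.trans htt.symm)))
    rw [et, ez, htt, hz] at this
    exact this.not_gt q1

end compose

lemma Config.compose {nO sO nI w j : ℕ} (hw : 0 < w) (hO : Config nO sO w) (hI : Config nI w j) :
    Config (nO + sO * 2 * nI) (sO * 2 * w) (j + 1) := by
  classical
  obtain ⟨O, hO, hOj⟩ := hO
  obtain ⟨I, hI, hIj⟩ := hI
  have hφ : ∀ B, Nonempty (Fin w ≃o {r // O r B}) := fun B =>
    ⟨Fintype.orderIsoFinOfCardEq _ (by rw [← Nat.card_eq_fintype_card, hOj])⟩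
  let φ : ∀ B, Fin w ≃o {r // O r B} := fun B => (hφ B).some
  let pos : Fin sO → Bool → Fin nO → Fin w := fun B h r =>
    if hr : O r B then (if h then (φ B).symm ⟨r, hr⟩ else ((φ B).symm ⟨r, hr⟩).rev) else ⟨0, hw⟩
  have htop : ∀ B, ∃ r, (∃ x ≤ B, O r x) ∧ ∀ r' x, x ≤ B → O r' x → r' ≤ r := by
    intro B
    obtain ⟨r, hr, hmax⟩ := (Finset.univ.filter fun r => ∃ x ≤ B, O r x).exists_max_image id
      ⟨(φ B ⟨0, hw⟩).1, Finset.mem_filter.2 ⟨Finset.mem_univ _, B, le_rfl, (φ B ⟨0, hw⟩).2⟩⟩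
    exact ⟨r, (Finset.mem_filter.1 hr).2, fun r' x hx hO' =>
      hmax r' (Finset.mem_filter.2 ⟨Finset.mem_univ _, x, hx, hO'⟩)⟩
  choose top hex hmax using htop
  refine Config.of_keys (height_injective (nI := nI) (top := top)) toLex.injective
    (sparse_compose (pos := pos) hO hI hmax hex ?_) (by simp) ?_ ?_
  · intro B r r' hr hr' hlt
    have h1 : (φ B).symm ⟨r, hr⟩ < (φ B).symm ⟨r', hr'⟩ := (φ B).symm.lt_iff_lt.2 hlt
    simpa [pos, hr, hr'] using h1
  · simp
  · intro x
    rw [Nat.card_congr Equiv.subtypeSum, Nat.card_sum, add_comm]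
    congr 1
    · rw [← hIj x.2]
      refine Nat.card_congr ⟨fun r => ⟨r.1.2, r.2.2⟩, fun r => ⟨(x.1, r.1), rfl, r.2⟩, ?_, ?_⟩
      · rintro ⟨⟨r1, r⟩, h1, h2⟩
        obtain rfl : r1 = x.1 := h1
        rfl
      · intro r
        rfl
    · obtain ⟨p, i⟩ := x
      let k : Fin w := if (ofLex p).2 then i else i.rev
      have hval : ∀ r (hr : O r (ofLex p).1), i = pos (ofLex p).1 (ofLex p).2 r ↔
          φ (ofLex p).1 k = ⟨r, hr⟩ := by
        intro r hr
        rw [← (φ (ofLex p).1).symm.injective.eq_iff]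
        simp only [pos, hr, k, dif_pos]
        cases (ofLex p).2 <;> simp [Fin.rev_eq_iff]
      rw [Nat.card_eq_one_iff_unique]
      refine ⟨⟨?_⟩, ⟨(φ (ofLex p).1 k).1, (φ (ofLex p).1 k).2, (hval _ _).2 rfl⟩⟩
      rintro ⟨r, hr, h1⟩ ⟨r', hr', h2⟩
      have := ((hval r hr).1 h1).symm.trans ((hval r' hr').1 h2)
      obtain rfl : r = r' := congrArg Subtype.val this
      rfl

/-! ### Dimensions of the recursive construction -/

/-- The number of columns of the matrix constructed with `j` 1s in each column. -/
def numCols : ℕ → ℕ → ℕ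
  | 0, _ => 1
  | _ + 1, 0 => 1
  | i + 1, j + 1 => numCols i (numCols (i + 1) j) * 2 * numCols (i + 1) j
termination_by i j => (i, j)

lemma numCols_zero (j : ℕ) : numCols 0 j = 1 := by rw [numCols]
lemma numCols_succ_zero (i : ℕ) : numCols (i + 1) 0 = 1 := by rw [numCols]
lemma numCols_succ_succ (i j : ℕ) : numCols (i + 1) (j + 1)
    = numCols i (numCols (i + 1) j) * 2 * numCols (i + 1) j := by rw [numCols]

lemma numCols_pos (i j : ℕ) : 0 < numCols i j := by
  induction i generalizing j with
  | zero => simp [numCols_zero]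
  | succ i ih =>
    induction j with
    | zero => simp [numCols_succ_zero]
    | succ j ihj =>
      rw [numCols_succ_succ]
      have := ih (numCols (i + 1) j)
      positivity

/-- The weight is `2 ^ i` times the number of rows: in a composition, outer rows double their
weight, and inner rows have weight `2 ^ (i + 1)` by induction on `j`. -/
lemma exists_config (i j : ℕ) : ∃ n, n * 2 ^ i = j * numCols i j ∧ Config n (numCols i j) j := by
  induction i generalizing j with
  | zero =>
    rw [numCols_zero]
    exact ⟨j, by simp, Config.single_column j⟩
  | succ i ih =>
    induction j with
    | zero => exact ⟨0, by simp, Config.no_rows _⟩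
    | succ j ihj =>
      obtain ⟨nI, hnI, hI⟩ := ihj
      obtain ⟨nO, hnO, hO⟩ := ih (numCols (i + 1) j)
      refine ⟨_, ?_, by rw [numCols_succ_succ]; exact hO.compose (numCols_pos _ _) hI⟩
      rw [numCols_succ_succ, add_mul, mul_assoc _ nI, hnI, pow_succ, ← mul_assoc, hnO]
      ring

lemma numCols_le_ack (i j : ℕ) : 2 * numCols i j ≤ ack i (i + j) := by
  induction i generalizing j with
  | zero => rw [numCols_zero, ack_zero]
  | succ i ih =>
    induction j with
    | zero =>
      rw [numCols_succ_zero]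
      exact two_le_ack (by omega)
    | succ j ihj =>
      rw [numCols_succ_succ, ← add_assoc]
      set w := numCols (i + 1) j
      have h1 : 2 ^ (i + 1) ≤ ack (i + 1) (i + 1 + j) :=
        (Nat.pow_le_pow_right two_pos (by omega)).trans (two_pow_le_ack _ _)
      have h2 : i < 2 ^ i := Nat.lt_two_pow_self
      rw [pow_succ] at h1
      have h3 := ack_succ_mul_le (i := i) (j := i + 1 + j) (k := i + w) (by omega)
      calc 2 * (numCols i w * 2 * w) = (2 * w) * (2 * numCols i w) := by ring
        _ ≤ ack (i + 1) (i + 1 + j) * ack i (i + w) := Nat.mul_le_mul ihj (ih w)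
        _ ≤ _ := h3

/-! ### The lower bound -/

lemma weight_le_Ex {k l n m : ℕ} {P : Mat k l} {A : Mat n m} (h : ¬ Contains P A) :
    weight A ≤ Ex P n m := by
  classical
  exact Finset.le_sup (f := weight) (Finset.mem_filter.2 ⟨Finset.mem_univ _, h⟩)

/-- The points of an occurrence of `W`. -/
lemma points_of_contains_W {n m : ℕ} {A : Mat n m} (h : Contains W A) :
    ∃ (a b c d : Fin n) (x y z t u : Fin m), a < b ∧ b < c ∧ c < d ∧ x < y ∧ y < z ∧ z < t ∧ t < u ∧
      A a x = true ∧ A d y = true ∧ A c z = true ∧ A d t = true ∧ A b u = true := by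
  obtain ⟨r, c, hr, hc, h⟩ := h
  exact ⟨r 0, r 1, r 2, r 3, c 0, c 1, c 2, c 3, c 4, hr (by decide), hr (by decide),
    hr (by decide), hc (by decide), hc (by decide), hc (by decide), hc (by decide),
    h 0 0 rfl, h 3 1 rfl, h 2 2 rfl, h 3 3 rfl, h 1 4 rfl⟩

lemma Config.mul_le_Ex {N S j n m : ℕ} (h : Config N S j) (hn : N ≤ n) (hm : S ≤ m) :
    S * j ≤ Ex W n m := by
  classical
  obtain ⟨A, hA, hj⟩ := h
  -- Heights in `Sparse` grow upwards, row numbers of a matrix downwards.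
  let e : Fin N → Fin n := fun r => (Fin.castLE hn r).rev
  let f : Fin S → Fin m := Fin.castLE hm
  have he : ∀ r r', e r < e r' ↔ r' < r := fun r r' => by simp [e]
  have hf : ∀ x y, f x < f y ↔ x < y := fun x y => by simp [f]
  let M : Mat n m := fun i k => decide (∃ r x, e r = i ∧ f x = k ∧ A r x)
  have hM : ¬ Contains W M := by
    intro hcon
    obtain ⟨a, b, c, d, x, y, z, t, u, h1, h2, h3, h4, h5, h6, h7, p1, p2, p3, p4, p5⟩ :=
      points_of_contains_W hcon
    simp only [M, decide_eq_true_eq] at p1 p2 p3 p4 p5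
    obtain ⟨a, x, rfl, rfl, p1⟩ := p1
    obtain ⟨d, y, rfl, rfl, p2⟩ := p2
    obtain ⟨c, z, rfl, rfl, p3⟩ := p3
    obtain ⟨d', t, hd, rfl, p4⟩ := p4
    obtain ⟨b, u, rfl, rfl, p5⟩ := p5
    obtain rfl : d' = d := by simpa [e] using hd
    rw [he] at h1 h2 h3
    rw [hf] at h4 h5 h6 h7
    exact hA a b c d' x y z t u h3 h2 h1.le h4.le h5.le h6.le (h5.trans h6) h7.le p1 p2 p3 p4 p5
  refine le_trans ?_ (weight_le_Ex hM)
  have hsum : S * j = (Finset.univ.sigma fun x : Fin S => Finset.univ.filter fun r => A r x).card := by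
    rw [Finset.card_sigma, Finset.sum_congr rfl fun x _ => ?_, Finset.sum_const, Finset.card_univ,
      Fintype.card_fin, smul_eq_mul]
    rw [← hj x, Nat.card_eq_fintype_card, Fintype.card_subtype]
  rw [hsum]
  refine Finset.card_le_card_of_injOn (fun p => (e p.2, f p.1)) ?_ ?_
  · rintro ⟨x, r⟩ hp
    have hp' : A r x := by simpa using hp
    simp only [Finset.coe_filter, Finset.mem_univ, true_and, Set.mem_ofPred_eq, M,
      decide_eq_true_eq]
    exact ⟨r, x, rfl, rfl, hp'⟩
  · rintro ⟨x, r⟩ - ⟨x', r'⟩ - hp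
    simp only [e, f, Prod.mk.injEq, Fin.rev_inj, Fin.castLE_inj] at hp
    rw [hp.1, hp.2]

lemma rows_le_Ex_W {n m : ℕ} (hm : 1 ≤ m) : n ≤ Ex W n m := by
  have h : Config n 1 n := Config.single_column n
  simpa using h.mul_le_Ex le_rfl hm

lemma cols_le_Ex_W {n m : ℕ} (hn : 1 ≤ n) : m ≤ Ex W n m := by
  have h : Config 1 m 1 := by
    refine ⟨fun _ _ => True, ?_, fun x => by simp⟩
    intro a b c d x y z t u h
    exact absurd h (by simp [Subsingleton.elim c d])
  simpa using h.mul_le_Ex hn le_rfl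

lemma le_ack_of_index (i : ℕ) {J : ℕ} (hJ : 3 ≤ J) : i + 2 ^ i * J ≤ ack (i + 1) (J - 1) := by
  induction J, hJ using Nat.le_induction with
  | base =>
    rw [show 3 - 1 = 2 from rfl, ack_two, pow_succ, pow_succ]
    have : i < 2 ^ i := Nat.lt_two_pow_self
    omega
  | succ J hJ ih =>
    have h1 := ack_succ_right_ge i (J - 1)
    rw [Nat.sub_add_cancel (by omega)] at h1
    have h2 : 2 ^ i * 1 ≤ 2 ^ i * J := Nat.mul_le_mul_left _ (by omega)
    have h3 : 2 ^ i * (J + 1) = 2 ^ i * J + 2 ^ i * 1 := by ring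
    rw [Nat.add_sub_cancel]
    omega

/-- The number of columns is much smaller than the Ackermann function two levels higher. -/
lemma numCols_sq_le (i : ℕ) {J : ℕ} (hJ : 3 ≤ J) :
    36 * numCols (i + 1) (2 ^ (i + 1) * J) ^ 2 ≤ ack (i + 3) J := by
  set S := numCols (i + 1) (2 ^ (i + 1) * J) with hS
  have h1 : 2 * S ≤ ack (i + 1) (i + 1 + 2 ^ (i + 1) * J) := numCols_le_ack _ _
  have h2 := le_ack_of_index (i + 1) hJ
  have h3 := ack_succ_mul_le h2
  rw [Nat.sub_add_cancel (by omega)] at h3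
  have h4 : 3 ≤ ack (i + 1 + 1) (J - 1) := by
    refine le_trans ?_ h2
    have : 1 * J ≤ 2 ^ (i + 1) * J := Nat.mul_le_mul_right _ Nat.one_le_two_pow
    omega
  have h5 : 6 * S ≤ ack (i + 2) J := by
    calc 6 * S = 3 * (2 * S) := by ring
      _ ≤ _ := Nat.mul_le_mul h4 h1
      _ ≤ _ := h3
  have h6 : J + 1 ≤ ack (i + 2 + 1) (J - 1) := by
    refine le_trans ?_ (le_ack_of_index (i + 2) hJ)
    have : 1 * J ≤ 2 ^ (i + 2) * J := Nat.mul_le_mul_right _ Nat.one_le_two_pow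
    omega
  have h7 := ack_succ_mul_le h6
  rw [Nat.sub_add_cancel (by omega)] at h7
  have h8 : ack (i + 2) J ≤ ack (i + 1) (ack (i + 2) J) :=
    (Nat.lt_two_pow_self.le).trans (two_pow_le_ack i _)
  calc 36 * S ^ 2 = (6 * S) * (6 * S) := by ring
    _ ≤ ack (i + 2) J * ack (i + 1) (ack (i + 2) J) := Nat.mul_le_mul h5 (h5.trans h8)
    _ = ack (i + 2) (J + 1) := (ack_succ_succ _ _).symm
    _ ≤ ack (i + 2 + 1) (J - 1) * ack (i + 2) (J + 1) :=
      Nat.le_mul_of_pos_left _ (ack_pos _ _)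
    _ ≤ _ := h7

lemma four_pow_le_ack (i : ℕ) : 4 ^ (i + 3) ≤ ack (i + 2) 3 := by
  rw [ack_succ_succ, ack_two]
  calc 4 ^ (i + 3) = 2 ^ (i + 1 + 1 + 1) * 2 ^ (i + 1 + 1 + 1) := by
        rw [← mul_pow]
        norm_num
    _ ≤ _ := Nat.mul_le_mul_left _ ((Nat.lt_two_pow_self.le).trans (two_pow_le_ack i _))

/-- The construction is used three levels below `alpha n m`, which costs a factor 8 and makes it
small compared with `m`. Rounding `n` to a multiple of `N` costs 2 and the summant `m` costs 1,
whence 17. -/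
lemma le_Ex_W {n m : ℕ} (hn : 1 ≤ n) (hm : 1 ≤ m) :
    m + n * 2 ^ alpha n m ≤ 17 * Ex W n m := by
  have hrow := rows_le_Ex_W (n := n) hm
  have hcol := cols_le_Ex_W (m := m) hn
  rcases Nat.lt_or_ge (alpha n m) 4 with hα | hα
  · have h1 : n * 2 ^ alpha n m ≤ n * 2 ^ 3 :=
      Nat.mul_le_mul_left _ (Nat.pow_le_pow_right two_pos (by omega))
    omega
  obtain ⟨i, hi⟩ : ∃ i, alpha n m = i + 4 := ⟨alpha n m - 4, by omega⟩
  have hJ := three_le_index n m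
  have hlt : ack (i + 3) (index n m) < m := ack_lt_of_lt_alpha (by omega) (by omega)
  have hS := numCols_sq_le i hJ
  -- This column weight makes the ratio of rows to columns exactly `index n m`, so copies that fit
  -- the rows also fit the columns.
  obtain ⟨N, hN, hconf⟩ := exists_config (i + 1) (2 ^ (i + 1) * index n m)
  set S := numCols (i + 1) (2 ^ (i + 1) * index n m) with hSdef
  have hS0 : 0 < S := numCols_pos _ _
  set J := index n m with hJdef
  have hNJ : N = J * S := by
    refine Nat.eq_of_mul_eq_mul_right (Nat.two_pow_pos (i + 1)) ?_
    rw [hN]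
    ring
  have hN0 : 0 < N := by
    rw [hNJ]
    positivity
  rw [hi]
  rcases Nat.lt_or_ge n N with hnN | hnN
  · rcases Nat.lt_or_ge n m with hnm | hnm
    -- Here `n < 3 * S` gives `n ^ 2 ≤ m`, and `4 ^ alpha n m ≤ m` as well, so the term `m`
    -- dominates.
    · have hJ3 : J = 3 := index_eq_three hm hnm.le
      rw [hJ3] at hlt hNJ
      have h4 : 4 ^ (i + 4) ≤ ack (i + 3) 3 := four_pow_le_ack (i + 1)
      have h5 : (n * 2 ^ (i + 4)) ^ 2 < m ^ 2 := by
        have h6 : n ^ 2 ≤ m := by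
          rw [hJ3] at hS
          nlinarith
        calc (n * 2 ^ (i + 4)) ^ 2 = n ^ 2 * 4 ^ (i + 4) := by
              rw [mul_pow, ← pow_mul, mul_comm (i + 4) 2, pow_mul]
              norm_num
          _ ≤ m * ack (i + 3) 3 := Nat.mul_le_mul h6 h4
          _ < m * m := Nat.mul_lt_mul_of_pos_left hlt (by omega)
          _ = m ^ 2 := by ring
      have h7 := lt_of_pow_lt_pow_left₀ 2 (by omega) h5
      omega
    -- This case is void: `3 * S ≤ m` gives `3 * N ≤ J * m ≤ 3 * n`.
    · have h1 := index_mul_le hm hnm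
      rw [← hJdef] at h1
      have h2 : 3 * S ≤ m := by nlinarith
      have h3 : J * (3 * S) ≤ J * m := Nat.mul_le_mul_left _ h2
      have h4 : J * (3 * S) = 3 * N := by rw [hNJ]; ring
      omega
  · set k := n / N with hk
    have hk1 : k * N ≤ n := Nat.div_mul_le_self _ _
    have hk2 : n < k * N + N := Nat.lt_div_mul_add hN0
    have hk3 : 1 ≤ k := (Nat.one_le_div_iff hN0).2 hnN
    have hkS : k * S ≤ m := by
      have h1 : J * (k * S) ≤ J * m := by
        calc J * (k * S) = k * N := by rw [hNJ]; ring
          _ ≤ n := hk1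
          _ ≤ J * m := le_index_mul hm
      exact Nat.le_of_mul_le_mul_left h1 (by omega)
    have h1 := (hconf.copies k).mul_le_Ex hk1 hkS
    have h2 : k * S * (2 ^ (i + 1) * J) = 2 ^ (i + 1) * (k * N) := by rw [hNJ]; ring
    have h3 : n ≤ 2 * (k * N) := by nlinarith
    have h4 : n * 2 ^ (i + 4) ≤ 2 * (k * N) * 2 ^ (i + 4) := Nat.mul_le_mul_right _ h3
    have h5 : 2 * (k * N) * 2 ^ (i + 4) = 16 * (2 ^ (i + 1) * (k * N)) := by
      rw [show i + 4 = (i + 1) + 3 by ring, pow_add]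
      ring
    omega

/-! ### Kronecker products with the hat -/

lemma Contains.trans {k l p q n m : ℕ} {P : Mat k l} {Q : Mat p q} {A : Mat n m}
    (h1 : Contains P Q) (h2 : Contains Q A) : Contains P A := by
  obtain ⟨r, c, hr, hc, h⟩ := h1
  obtain ⟨r', c', hr', hc', h'⟩ := h2
  exact ⟨r' ∘ r, c' ∘ c, hr'.comp hr, hc'.comp hc, fun i j hij => h' _ _ (h _ _ hij)⟩

lemma Ex_mono {k l p q n m : ℕ} {P : Mat k l} {Q : Mat p q} (h : Contains P Q) :
    Ex P n m ≤ Ex Q n m := by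
  classical
  refine Finset.sup_le fun A hA => weight_le_Ex fun h2 => ?_
  exact (Finset.mem_filter.1 hA).2 (h.trans h2)

lemma Ex_W'_ge (n m : ℕ) : Ex W n m ≤ Ex W' n m := by
  classical
  refine Finset.sup_le fun A hA => ?_
  have hA := (Finset.mem_filter.1 hA).2
  let A' : Mat n m := fun i j => A i j.rev
  have hA' : ¬ Contains W' A' := by
    rintro ⟨r, c, hr, hc, h⟩
    refine hA ⟨r, fun j => (c j.rev).rev, hr, ?_, fun i j hij => h i j.rev ?_⟩
    · intro i j hij
      exact Fin.rev_lt_rev.2 (hc (Fin.rev_lt_rev.2 hij))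
    · simpa [W'] using hij
  refine le_trans (le_of_eq ?_) (weight_le_Ex hA')
  refine Finset.card_bij (fun p _ => (p.1, p.2.rev)) ?_ ?_ ?_
  · intro p hp
    simpa [A'] using hp
  · rintro ⟨i, j⟩ _ ⟨i', j'⟩ _ h
    simpa using h
  · rintro ⟨i, j⟩ hp
    exact ⟨(i, j.rev), by simpa [A'] using hp, by simp⟩

lemma kron_apply {k l p q : ℕ} (P : Mat k l) (R : Mat p q) (i : Fin k) (i' : Fin p) (j : Fin l)
    (j' : Fin q) : kron P R (finProdFinEquiv (i, i')) (finProdFinEquiv (j, j'))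
      = (P i j && R i' j') := by
  simp [kron]

lemma finProd_lt_of_lt {k p : ℕ} {i j : Fin k} (i' j' : Fin p) (h : i < j) :
    finProdFinEquiv (i, i') < finProdFinEquiv (j, j') := by
  rw [Fin.lt_def]
  simp only [finProdFinEquiv_apply_val]
  have h1 : (i : ℕ) + 1 ≤ j := h
  have h2 := i'.isLt
  have h3 := Nat.mul_le_mul_left p h1
  rw [mul_add] at h3
  omega

lemma finProd_lt_snd {k p : ℕ} (i : Fin k) {i' j' : Fin p} (h : i' < j') :
    finProdFinEquiv (i, i') < finProdFinEquiv (i, j') := by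
  rw [Fin.lt_def]
  simp only [finProdFinEquiv_apply_val]
  have h1 : (i' : ℕ) < j' := h
  omega

lemma permMatrix_apply {k : ℕ} (π : Equiv.Perm (Fin k)) (j : Fin k) :
    permMatrix π (π j).rev j = true := by
  simp [permMatrix]

lemma contains_W_kron {k : ℕ} {π : Equiv.Perm (Fin k)} (h : PermContains π ![3, 1, 2]) :
    Contains W (kron (permMatrix π) hat) := by
  obtain ⟨f, hf, h⟩ := h
  have h12 : π (f 1) < π (f 2) := (h 1 2).2 (by simp)
  have h20 : π (f 2) < π (f 0) := (h 2 0).2 (by simp)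
  have f01 : f 0 < f 1 := hf (by decide)
  have f12 : f 1 < f 2 := hf (by decide)
  refine contains_W (a := finProdFinEquiv ((π (f 0)).rev, 0))
    (b := finProdFinEquiv ((π (f 2)).rev, 0)) (c := finProdFinEquiv ((π (f 1)).rev, 0))
    (d := finProdFinEquiv ((π (f 1)).rev, 1)) (x := finProdFinEquiv (f 0, 1))
    (y := finProdFinEquiv (f 1, 0)) (z := finProdFinEquiv (f 1, 1)) (t := finProdFinEquiv (f 1, 2))
    (u := finProdFinEquiv (f 2, 1)) (finProd_lt_of_lt _ _ (Fin.rev_lt_rev.2 h20))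
    (finProd_lt_of_lt _ _ (Fin.rev_lt_rev.2 h12)) (finProd_lt_snd _ (by decide))
    (finProd_lt_of_lt _ _ f01) (finProd_lt_snd _ (by decide)) (finProd_lt_snd _ (by decide))
    (finProd_lt_of_lt _ _ f12) ?_ ?_ ?_ ?_ ?_ <;>
  · rw [kron_apply, permMatrix_apply]
    simp [hat]

lemma contains_W'_kron {k : ℕ} {π : Equiv.Perm (Fin k)} (h : PermContains π ![2, 1, 3]) :
    Contains W' (kron (permMatrix π) hat) := by
  obtain ⟨f, hf, h⟩ := h
  have h10 : π (f 1) < π (f 0) := (h 1 0).2 (by simp)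
  have h02 : π (f 0) < π (f 2) := (h 0 2).2 (by simp)
  have f01 : f 0 < f 1 := hf (by decide)
  have f12 : f 1 < f 2 := hf (by decide)
  refine ⟨![finProdFinEquiv ((π (f 2)).rev, 0), finProdFinEquiv ((π (f 0)).rev, 0),
    finProdFinEquiv ((π (f 1)).rev, 0), finProdFinEquiv ((π (f 1)).rev, 1)],
    ![finProdFinEquiv (f 0, 1), finProdFinEquiv (f 1, 0), finProdFinEquiv (f 1, 1),
      finProdFinEquiv (f 1, 2), finProdFinEquiv (f 2, 1)],
    strictMono_vec ?_, strictMono_vec ?_, ?_⟩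
  · intro i
    fin_cases i
    · exact finProd_lt_of_lt _ _ (Fin.rev_lt_rev.2 h02)
    · exact finProd_lt_of_lt _ _ (Fin.rev_lt_rev.2 h10)
    · exact finProd_lt_snd _ (by decide)
  · intro i
    fin_cases i
    · exact finProd_lt_of_lt _ _ f01
    · exact finProd_lt_snd _ (by decide)
    · exact finProd_lt_snd _ (by decide)
    · exact finProd_lt_of_lt _ _ f12
  · intro i j hij
    fin_cases i <;> fin_cases j <;> first
      | exact absurd hij (by decide)
      | exact (kron_apply _ _ _ _ _ _).trans (by rw [permMatrix_apply]; simp [hat])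

end ZeroOneMatrix

open ZeroOneMatrix in
theorem mainTheorem3 :
    (∃ c C : ℝ, 0 < c ∧ 0 < C ∧ ∀ n m : ℕ, 1 ≤ n → 1 ≤ m →
      c * ((m : ℝ) + (n : ℝ) * (2 : ℝ) ^ ZeroOneMatrix.alpha n m)
          ≤ (ZeroOneMatrix.Ex ZeroOneMatrix.W n m : ℝ) ∧
      (ZeroOneMatrix.Ex ZeroOneMatrix.W n m : ℝ)
          ≤ C * ((m : ℝ) + (n : ℝ) * (2 : ℝ) ^ ZeroOneMatrix.alpha n m)) ∧
    ((fun n : ℕ => (ZeroOneMatrix.Ex ZeroOneMatrix.W n n : ℝ)) =Θ[atTop]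
      fun n : ℕ => (n : ℝ) * (2 : ℝ) ^ ZeroOneMatrix.alpha n n) ∧
    (∀ (k : ℕ) (π : Equiv.Perm (Fin k)),
      (ZeroOneMatrix.PermContains π ![3, 1, 2] →
        ZeroOneMatrix.Contains ZeroOneMatrix.W
          (ZeroOneMatrix.kron (ZeroOneMatrix.permMatrix π) ZeroOneMatrix.hat)) ∧
      (ZeroOneMatrix.PermContains π ![2, 1, 3] →
        ZeroOneMatrix.Contains ZeroOneMatrix.W'
          (ZeroOneMatrix.kron (ZeroOneMatrix.permMatrix π) ZeroOneMatrix.hat))) ∧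
    (∃ c : ℝ, 0 < c ∧ ∀ (k : ℕ) (π : Equiv.Perm (Fin k)),
      (ZeroOneMatrix.PermContains π ![3, 1, 2] ∨ ZeroOneMatrix.PermContains π ![2, 1, 3]) →
      ∀ n : ℕ, 1 ≤ n →
        c * ((n : ℝ) * (2 : ℝ) ^ ZeroOneMatrix.alpha n n)
          ≤ (ZeroOneMatrix.Ex
              (ZeroOneMatrix.kron (ZeroOneMatrix.permMatrix π) ZeroOneMatrix.hat) n n : ℝ)) := by
  have hupper : ∀ n m : ℕ, 1 ≤ n → 1 ≤ m →
      (Ex W n m : ℝ) ≤ 7258 * ((m : ℝ) + (n : ℝ) * (2 : ℝ) ^ alpha n m) := fun n m hn hm => by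
    exact_mod_cast Ex_W_le hn hm
  have hlower : ∀ n m : ℕ, 1 ≤ n → 1 ≤ m →
      (m : ℝ) + (n : ℝ) * (2 : ℝ) ^ alpha n m ≤ 17 * (Ex W n m : ℝ) := fun n m hn hm => by
    exact_mod_cast le_Ex_W hn hm
  refine ⟨⟨1 / 17, 7258, by norm_num, by norm_num, fun n m hn hm => ⟨?_, hupper n m hn hm⟩⟩,
    ⟨?_, ?_⟩, fun k π => ⟨contains_W_kron, contains_W'_kron⟩,
    ⟨1 / 17, by norm_num, fun k π hπ n hn => ?_⟩⟩
  · have := hlower n m hn hm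
    linarith
  -- Twice 7258, since for `m = n` the summand `m` is at most the other one.
  · refine IsBigO.of_bound 14516 ?_
    filter_upwards [eventually_ge_atTop 1] with n hn
    rw [Real.norm_of_nonneg (by positivity), Real.norm_of_nonneg (by positivity)]
    have h1 := hupper n n hn hn
    have h2 : (n : ℝ) * 1 ≤ (n : ℝ) * 2 ^ alpha n n :=
      mul_le_mul_of_nonneg_left (one_le_pow₀ one_le_two) (by positivity)
    linarith
  · refine IsBigO.of_bound 17 ?_
    filter_upwards [eventually_ge_atTop 1] with n hn
    rw [Real.norm_of_nonneg (by positivity), Real.norm_of_nonneg (by positivity)]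
    have h1 := hlower n n hn hn
    have h2 : (0 : ℝ) ≤ n := by positivity
    linarith
  · have h1 : Ex W n n ≤ Ex (kron (permMatrix π) hat) n n := by
      rcases hπ with h | h
      · exact Ex_mono (contains_W_kron h)
      · exact (Ex_W'_ge n n).trans (Ex_mono (contains_W'_kron h))
    have h2 : (Ex W n n : ℝ) ≤ (Ex (kron (permMatrix π) hat) n n : ℝ) := by exact_mod_cast h1
    have h3 := hlower n n hn hn
    have h4 : (0 : ℝ) ≤ n := by positivity
    linarith
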